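/- There is a polynomial-time algorithm that computes the $2$-rainbow domination number of permutation graphs. In detail: for a finite simple graph $G=(V,E)$, a function $f\colon V\to 2^{\{1,2\}}$ is a $2$-rainbow function if $\bigcup_{y\in N(x)} f(y)=\{1,2\}$ for every vertex $x$ with $f(x)=\varnothing$, and $\gamma_{r2}(G)=\min_f \sum_{x\in V}|f(x)|$, the minimum being taken over all $2$-rainbow functions $f$ of $G$. A graph is a permutation graph if it is the intersection graph of straight line segments that have their endpoints on two parallel lines. Then there exist a random access machine program (with unit-cost addition and subtraction and without multiplication) and a polynomial $p$ such that, for every $n\ge 0$ and every permutation graph $G$ with vertex set $\{0,\dots,n-1\}$, the program, given $n$ and the adjacency matrix of $G$ (and no segment representation), halts after at most $p(n)$ steps with output $\gamma_{r2}(G)$. -/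

import Mathlib

/-! ### Rainbow domination -/

/-- `f` assigns to every vertex a set of colors from a palette of `k` colors; it is a `k`-rainbow
function if the neighbors of every vertex with an empty label together show all `k` colors. -/
def IsRainbowFunction {V : Type*} (k : ℕ) (G : SimpleGraph V) (f : V → Finset (Fin k)) : Prop :=
  ∀ x : V, f x = ∅ → ∀ c : Fin k, ∃ y : V, G.Adj x y ∧ c ∈ f y

/-- The cost `‖f‖ = ∑ x, |f x|` of a labeling. -/
def rainbowCost {V : Type*} [Fintype V] {k : ℕ} (f : V → Finset (Fin k)) : ℕ :=
  ∑ x : V, (f x).card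

/-- The `k`-rainbow domination number: the minimum cost of a `k`-rainbow function.
The set below is never empty, so that the infimum is a minimum: see
`rainbowDominationNumber_isLeast`. -/
noncomputable def rainbowDominationNumber {V : Type*} [Fintype V] (k : ℕ)
    (G : SimpleGraph V) : ℕ :=
  sInf {c : ℕ | ∃ f : V → Finset (Fin k), IsRainbowFunction k G f ∧ rainbowCost f = c}

theorem rainbowDominationNumber_isLeast {V : Type*} [Fintype V] (k : ℕ) (G : SimpleGraph V) :
    IsLeast {c : ℕ | ∃ f : V → Finset (Fin k), IsRainbowFunction k G f ∧ rainbowCost f = c}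
      (rainbowDominationNumber k G) := by
  refine ⟨Nat.sInf_mem ⟨_, fun _ => Finset.univ, ?_, rfl⟩, fun c hc => Nat.sInf_le hc⟩
  intro x hx c
  have h : c ∈ (∅ : Finset (Fin k)) := hx ▸ Finset.mem_univ c
  simp at h

/-! ### Permutation graphs -/

/-- The straight line segment from the point `a` of the line `y = 0` to the point `b` of the
parallel line `y = 1`. -/
def diagramSegment (a b : ℝ) : Set (ℝ × ℝ) :=
  segment ℝ ((a, 0) : ℝ × ℝ) (b, 1)

/-- A graph is a permutation graph if it is the intersection graph of straight line segments that
have their endpoints on two parallel lines. The segment of the vertex `v` runs from `p v` on one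
line to `q v` on the other. -/
def IsPermutationGraph {V : Type*} (G : SimpleGraph V) : Prop :=
  ∃ p q : V → ℝ, ∀ u v : V, u ≠ v →
    (G.Adj u v ↔ (diagramSegment (p u) (q u) ∩ diagramSegment (p v) (q v)).Nonempty)

/-! ### Random access machines

The machine is the random access machine with unit-cost addition and subtraction, and without
multiplication, in structured form. Its memory consists of registers that hold natural numbers. The
registers are organized in banks: a program names the (finitely many) banks that it uses, and
addresses the registers of a bank by computed indices. Up to a polynomial this cost measure agrees
with the running time of Turing machines. -/

/-- A memory: `s b i` is the content of register `i` of bank `b`. -/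
abbrev RAM.State : Type := ℕ → ℕ → ℕ

/-- Expressions: constants, register contents (`read b e` is the register of bank `b` whose index
is the value of `e`), sums, and truncated differences. -/
inductive RAM.Expr : Type
  | const (m : ℕ)
  | read (b : ℕ) (e : RAM.Expr)
  | add (e₁ e₂ : RAM.Expr)
  | sub (e₁ e₂ : RAM.Expr)

/-- The value of an expression in a memory. -/
def RAM.Expr.val (s : RAM.State) : RAM.Expr → ℕ
  | .const m => m
  | .read b e => s b (e.val s)
  | .add e₁ e₂ => e₁.val s + e₂.val s
  | .sub e₁ e₂ => e₁.val s - e₂.val s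

/-- The number of steps for the evaluation of an expression: one for every operation in it. -/
def RAM.Expr.cost : RAM.Expr → ℕ
  | .const _ => 1
  | .read _ e => e.cost + 1
  | .add e₁ e₂ => e₁.cost + e₂.cost + 1
  | .sub e₁ e₂ => e₁.cost + e₂.cost + 1

/-- Programs. `write b i e` stores the value of `e` in the register of bank `b` whose index is the
value of `i`. The tests of `ite` and `loop` succeed when the value of the expression is nonzero. -/
inductive RAM.Program : Type
  | skip
  | write (b : ℕ) (i e : RAM.Expr)
  | seq (P Q : RAM.Program)
  | ite (e : RAM.Expr) (P Q : RAM.Program)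
  | loop (e : RAM.Expr) (P : RAM.Program)

/-- The memory `s` after the value `v` has been written into register `i` of bank `b`. -/
def RAM.State.set (s : RAM.State) (b i v : ℕ) : RAM.State :=
  fun b' i' => if b' = b ∧ i' = i then v else s b' i'

/-- `RAM.Exec P s s' t`: the program `P`, started in the memory `s`, halts in the memory `s'`
after exactly `t` steps. -/
inductive RAM.Exec : RAM.Program → RAM.State → RAM.State → ℕ → Prop
  | skip (s : RAM.State) : RAM.Exec .skip s s 1
  | write (b : ℕ) (i e : RAM.Expr) (s : RAM.State) :
      RAM.Exec (.write b i e) s (s.set b (i.val s) (e.val s)) (i.cost + e.cost + 1)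
  | seq {P Q : RAM.Program} {s s' s'' : RAM.State} {t t' : ℕ} :
      RAM.Exec P s s' t → RAM.Exec Q s' s'' t' → RAM.Exec (.seq P Q) s s'' (t + t')
  | ite_true {e : RAM.Expr} {P Q : RAM.Program} {s s' : RAM.State} {t : ℕ} :
      e.val s ≠ 0 → RAM.Exec P s s' t → RAM.Exec (.ite e P Q) s s' (e.cost + 1 + t)
  | ite_false {e : RAM.Expr} {P Q : RAM.Program} {s s' : RAM.State} {t : ℕ} :
      e.val s = 0 → RAM.Exec Q s s' t → RAM.Exec (.ite e P Q) s s' (e.cost + 1 + t)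
  | loop_true {e : RAM.Expr} {P : RAM.Program} {s s' s'' : RAM.State} {t t' : ℕ} :
      e.val s ≠ 0 → RAM.Exec P s s' t → RAM.Exec (.loop e P) s' s'' t' →
      RAM.Exec (.loop e P) s s'' (e.cost + 1 + t + t')
  | loop_false {e : RAM.Expr} {P : RAM.Program} {s : RAM.State} :
      e.val s = 0 → RAM.Exec (.loop e P) s s (e.cost + 1)

/-- Programs are deterministic: the final memory and the number of steps are determined by the
initial memory. -/
theorem RAM.Exec.deterministic {P : RAM.Program} {s s₁ s₂ : RAM.State} {t₁ t₂ : ℕ}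
    (h₁ : RAM.Exec P s s₁ t₁) (h₂ : RAM.Exec P s s₂ t₂) : s₁ = s₂ ∧ t₁ = t₂ := by
  induction h₁ generalizing s₂ t₂ with
  | skip s => cases h₂; exact ⟨rfl, rfl⟩
  | write b i e s => cases h₂; exact ⟨rfl, rfl⟩
  | seq _ _ ih ih' =>
    cases h₂ with
    | seq k k' =>
      obtain ⟨rfl, rfl⟩ := ih k
      obtain ⟨rfl, rfl⟩ := ih' k'
      exact ⟨rfl, rfl⟩
  | ite_true he _ ih =>
    cases h₂ with
    | ite_true _ k => obtain ⟨rfl, rfl⟩ := ih k; exact ⟨rfl, rfl⟩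
    | ite_false he' _ => exact absurd he' he
  | ite_false he _ ih =>
    cases h₂ with
    | ite_true he' _ => exact absurd he he'
    | ite_false _ k => obtain ⟨rfl, rfl⟩ := ih k; exact ⟨rfl, rfl⟩
  | loop_true he _ _ ih ih' =>
    cases h₂ with
    | loop_true _ k k' =>
      obtain ⟨rfl, rfl⟩ := ih k
      obtain ⟨rfl, rfl⟩ := ih' k'
      exact ⟨rfl, rfl⟩
    | loop_false he' => exact absurd he' he
  | loop_false he =>
    cases h₂ with
    | loop_true he' _ _ => exact absurd he he'
    | loop_false _ => exact ⟨rfl, rfl⟩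

/-! ### Polynomial-time computation of graph parameters -/

open Classical in
/-- The input memory for a graph on `n` labeled vertices: register `0` of bank `0` holds `n`, bank
`1` holds the adjacency matrix, row after row, and all other registers hold `0`. -/
noncomputable def RAM.graphInput {n : ℕ} (G : SimpleGraph (Fin n)) : RAM.State :=
  fun b i =>
    if b = 0 ∧ i = 0 then n
    else if b = 1 ∧ ∃ u v : Fin n, G.Adj u v ∧ i = (u : ℕ) * n + (v : ℕ) then 1
    else 0

/-- The parameter `φ` can be computed in polynomial time on the graphs of the class `C`: there are
one program and one polynomial such that, for every graph of the class, given by its adjacency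
matrix with respect to an arbitrary numbering of its vertices, the program halts within the
polynomial number of steps and leaves the value of the parameter in register `0` of bank `0`. -/
def PolyTimeComputableOn (C : ∀ n : ℕ, SimpleGraph (Fin n) → Prop)
    (φ : ∀ n : ℕ, SimpleGraph (Fin n) → ℕ) : Prop :=
  ∃ (P : RAM.Program) (p : Polynomial ℕ), ∀ (n : ℕ) (G : SimpleGraph (Fin n)), C n G →
    ∃ (s : RAM.State) (t : ℕ),
      RAM.Exec P (RAM.graphInput G) s t ∧ t ≤ p.eval n ∧ s 0 0 = φ n G

/-! The graph is swept by a breadth-first layering that needs no segments: when a component is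
exhausted, a single vertex of another one forms the next layer (`greedyLayering`). Edges stay within
a layer or join consecutive layers. In a permutation graph every layer is dominated by four vertices
(`IsDiagram.exists_dominating`), because all vertices two layers before a vertex `y` lie on one side
of `y`, so that among the vertices of the preceding layer those with extreme endpoints on that side
suffice.

This bounds the weight of an optimal function on a layer (`IsLayering.weight_le`). Giving both
colors to the dominators of three consecutive layers makes the labels of the middle layer
superfluous and costs at most `2 * 3 * 4 = 24`.

A dynamic program therefore only needs the labels of two consecutive layers, as two blocks of 24
numbers, and the cost so far: a tuple of 49 numbers below `N = 2 * n + 2`, hence one of polynomially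
many. `Reachable.exists_labeling` gives soundness and `reachable_of_isRainbowFunction` completeness;
`rainbowDominationNumber_isLeast_reachable` combines them.

For the machine, `Dec`, `Scatter` and `Task` describe polynomial-time tests, guarded writes and
memory transformations, and are closed under the constructions needed. Their loops run below `N`,
stored in bank 4, with nesting depth independent of the graph. Tables of multiples replace
multiplication. Banks 5 and 6 hold the layering, banks 7 and 8 the reachable configurations, bank 9
the row positions, and banks `100 + j` the multiples of `N ^ j`. -/

namespace RAM

/-! ### Memories that agree outside the scratch registers -/

/-- The memories `s` and `s'` agree outside the scratch bank `3`, the bank `c` and the loop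
variables with index at least `d`, which are held in bank `2`. -/
def Agree (d c : ℕ) (s s' : State) : Prop :=
  ∀ b i, b ≠ 3 → b ≠ c → (b = 2 → i < d) → s b i = s' b i

theorem Agree.refl (d c : ℕ) (s : State) : Agree d c s s := fun _ _ _ _ _ => rfl

theorem Agree.symm {d c : ℕ} {s s' : State} (h : Agree d c s s') : Agree d c s' s :=
  fun b i h₁ h₂ h₃ => (h b i h₁ h₂ h₃).symm

theorem Agree.trans {d c : ℕ} {s s' s'' : State} (h : Agree d c s s') (h' : Agree d c s' s'') :
    Agree d c s s'' :=
  fun b i h₁ h₂ h₃ => (h b i h₁ h₂ h₃).trans (h' b i h₁ h₂ h₃)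

theorem Agree.weaken {d d' c c' : ℕ} {s s' : State} (h : Agree d c s s') (hd : d' ≤ d)
    (hc : c = 3 ∨ c = c') : Agree d' c' s s' := by
  intro b i h₁ h₂ h₃
  refine h b i h₁ ?_ (fun hb => lt_of_lt_of_le (h₃ hb) hd)
  rcases hc with rfl | rfl
  · exact h₁
  · exact h₂

@[simp] theorem State.set_same (s : State) (b i v : ℕ) : s.set b i v b i = v := by
  simp [State.set]

theorem State.set_bank {s : State} {b i v b' : ℕ} (h : b' ≠ b) (i' : ℕ) :
    s.set b i v b' i' = s b' i' := by
  simp [State.set, h]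

theorem State.set_index {s : State} {b i v b' i' : ℕ} (h : i' ≠ i) :
    s.set b i v b' i' = s b' i' := by
  simp [State.set, h]

theorem Agree.set_left {d c : ℕ} {s s' : State} (h : Agree d c s s') (b i v : ℕ)
    (hb : b = 3 ∨ b = c ∨ (b = 2 ∧ d ≤ i)) : Agree d c (s.set b i v) s' := by
  intro b' i' h₁ h₂ h₃
  rw [← h b' i' h₁ h₂ h₃]
  rcases hb with rfl | rfl | ⟨rfl, hd⟩
  · exact State.set_bank h₁ _
  · exact State.set_bank h₂ _
  · by_cases hb' : b' = 2
    · have := h₃ hb'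
      exact State.set_index (by omega)
    · exact State.set_bank hb' _

theorem Agree.set_right {d c : ℕ} {s s' : State} (h : Agree d c s s') (b i v : ℕ)
    (hb : b = 3 ∨ b = c ∨ (b = 2 ∧ d ≤ i)) : Agree d c s (s'.set b i v) :=
  (h.symm.set_left b i v hb).symm

theorem Agree.set_set {d c : ℕ} {s s' : State} (h : Agree d c s s') (v : ℕ) :
    Agree (d + 1) c (s.set 2 d v) (s'.set 2 d v) := by
  intro b i h₁ h₂ h₃
  by_cases hb : b = 2 ∧ i = d
  · simp [State.set, hb]
  · have : s b i = s' b i := h b i h₁ h₂ (fun hb' => by have := h₃ hb'; omega)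
    simp [State.set, hb, this]

theorem Agree.set_eq {d c : ℕ} {s s' : State} (h : Agree d c s s') :
    Agree (d + 1) c (s.set 2 d (s' 2 d)) s' := by
  intro b i h₁ h₂ h₃
  by_cases hb : b = 2 ∧ i = d
  · simp [State.set, hb]
  · simpa [State.set, hb] using h b i h₁ h₂ (fun hb' => by have := h₃ hb'; omega)

theorem Agree.lim {d c : ℕ} {s s' : State} (h : Agree d c s s') (hc : c ≠ 4) :
    s 4 0 = s' 4 0 :=
  h 4 0 (by decide) hc.symm (fun h => absurd h (by decide))

theorem Agree.var {d c j : ℕ} {s s' : State} (h : Agree d c s s') (hc : c ≠ 2) (hj : j < d) :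
    s 2 j = s' 2 j :=
  h 2 j (by decide) hc.symm (fun _ => hj)

/-- `F` depends neither on the scratch registers nor on bank `c`. -/
def Local {α : Type*} (d c : ℕ) (F : State → α) : Prop :=
  ∀ s s', Agree d c s s' → F s = F s'

/-! ### Expressions -/

/-- The loop variable with index `j`. -/
abbrev Expr.var (j : ℕ) : Expr := .read 2 (.const j)

/-- The common bound of all loops. -/
abbrev Expr.lim : Expr := .read 4 (.const 0)

/-- The result of the last test. -/
abbrev Expr.res : Expr := .read 3 (.const 0)

theorem local_const {d c : ℕ} (m : ℕ) : Local d c (Expr.val · (.const m)) := fun _ _ _ => rfl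

theorem local_var {d c j : ℕ} (hc : c ≠ 2) (hj : j < d) : Local d c (Expr.val · (.var j)) :=
  fun _ _ h => h.var hc hj

theorem local_read {d c b : ℕ} {e : Expr} (he : Local d c (Expr.val · e)) (h₂ : b ≠ 2)
    (h₃ : b ≠ 3) (hc : b ≠ c) : Local d c (Expr.val · (.read b e)) := by
  intro s s' h
  have := he s s' h
  simp only [Expr.val] at this ⊢
  rw [this]
  exact h b _ h₃ hc (fun hb => absurd hb h₂)

theorem local_add {d c : ℕ} {e e' : Expr} (he : Local d c (Expr.val · e))
    (he' : Local d c (Expr.val · e')) : Local d c (Expr.val · (.add e e')) := by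
  intro s s' h
  have h₁ := he s s' h
  have h₂ := he' s s' h
  simp only [Expr.val] at h₁ h₂ ⊢
  rw [h₁, h₂]

theorem local_sub {d c : ℕ} {e e' : Expr} (he : Local d c (Expr.val · e))
    (he' : Local d c (Expr.val · e')) : Local d c (Expr.val · (.sub e e')) := by
  intro s s' h
  have h₁ := he s s' h
  have h₂ := he' s s' h
  simp only [Expr.val] at h₁ h₂ ⊢
  rw [h₁, h₂]

/-! ### Bounded loops -/

/-- Run `P` for the values `0, 1, …` of the loop variable `d` below the common bound. -/
def Program.for (d : ℕ) (P : Program) : Program :=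
  .seq (.write 2 (.const d) (.const 0))
    (.loop (.sub .lim (.var d)) (.seq P (.write 2 (.const d) (.add (.var d) (.const 1)))))

/-- The loop control reads only the counter and the bound, so the invariant has to pin down nothing
else. A round costs 6 for the guard and 6 for the increment on top of the body, which gives the 12;
the initialization costs 3. -/
theorem exec_for {d : ℕ} {P : Program} {N T : ℕ} {I : ℕ → State → Prop}
    (hI : ∀ i s, I i s → s 4 0 = N ∧ s 2 d = i)
    (hP : ∀ i s, i < N → I i s → ∃ s' t, Exec P s s' t ∧ t ≤ T ∧ s' 2 d = i ∧
      I (i + 1) (s'.set 2 d (i + 1)))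
    {s : State} (hs : I 0 (s.set 2 d 0)) :
    ∃ s' t, Exec (P.for d) s s' t ∧ t ≤ (N + 1) * (T + 12) + 3 ∧ I N s' := by
  have key : ∀ m i s, i + m = N → I i s → ∃ s' t,
      Exec (.loop (.sub .lim (.var d)) (.seq P (.write 2 (.const d) (.add (.var d) (.const 1)))))
        s s' t ∧ t ≤ (m + 1) * (T + 12) ∧ I N s' := by
    intro m
    induction m with
    | zero =>
      intro i s hi h
      obtain ⟨h₁, h₂⟩ := hI i s h
      obtain rfl : i = N := by omega
      refine ⟨s, _, Exec.loop_false ?_, ?_, h⟩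
      · simp [Expr.val, h₁, h₂]
      · simp only [Expr.cost]; omega
    | succ m ih =>
      intro i s hi h
      obtain ⟨h₁, h₂⟩ := hI i s h
      obtain ⟨s', t, he, ht, hv, h'⟩ := hP i s (by omega) h
      obtain ⟨s'', t', he', ht', h''⟩ := ih (i + 1) _ (by omega) h'
      have hw := Exec.write 2 (.const d) (.add (.var d) (.const 1)) s'
      simp only [Expr.val, Expr.cost, hv] at hw
      refine ⟨s'', _, Exec.loop_true ?_ (Exec.seq he hw) he', ?_, h''⟩
      · simp only [Expr.val, h₁, h₂]; omega
      · have : (m + 1 + 1) * (T + 12) = (m + 1) * (T + 12) + (T + 12) := by ring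
        simp only [Expr.cost]
        omega
  obtain ⟨s', t, he, ht, h⟩ := key N 0 _ (by omega) hs
  refine ⟨s', _, Exec.seq (Exec.write _ _ _ _) he, ?_, h⟩
  simp only [Expr.cost]
  omega

/-! ### Predicates on memories that can be tested in polynomial time -/

/-- The predicate `Q` does not depend on bank `c`, and can be tested in polynomial time. -/
def Dec (d c : ℕ) (Q : State → Prop) : Prop :=
  Local d c Q ∧ ∃ (P : Program) (p : Polynomial ℕ), ∀ s, ∃ s' t, Exec P s s' t ∧
    t ≤ p.eval (s 4 0) ∧ Agree d 3 s s' ∧ (Q s ∧ s' 3 0 = 1 ∨ ¬ Q s ∧ s' 3 0 = 0)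

section Dec

variable {d c : ℕ} {Q Q' : State → Prop}

theorem Dec.congr (h : Dec d c Q) (hQ : ∀ s, Q s ↔ Q' s) : Dec d c Q' := by
  obtain rfl : Q = Q' := funext fun s => propext (hQ s)
  exact h

theorem Dec.atom {e : Expr} (he : Local d c (Expr.val · e)) : Dec d c (fun s => e.val s ≠ 0) := by
  refine ⟨fun s s' h => ?_, .write 3 (.const 0) (.sub (.const 1) (.sub (.const 1) e)),
    Polynomial.C (e.cost + 6), fun s => ⟨_, _, Exec.write _ _ _ _, ?_, ?_, ?_⟩⟩
  · have := he s s' h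
    simp only at this
    simp [this]
  · simp only [Expr.cost, Polynomial.eval_C]; omega
  · exact (Agree.refl _ _ _).set_right _ _ _ (Or.inl rfl)
  · simp only [Expr.val, State.set_same]
    omega

theorem Dec.not (h : Dec d c Q) : Dec d c (fun s => ¬ Q s) := by
  obtain ⟨hl, P, p, hP⟩ := h
  refine ⟨fun s s' h => by simp only [hl s s' h],
    .seq P (.write 3 (.const 0) (.sub (.const 1) .res)), p + Polynomial.C 10, fun s => ?_⟩
  obtain ⟨s', t, he, ht, ha, hr⟩ := hP s
  refine ⟨_, _, Exec.seq he (Exec.write _ _ _ _), ?_, ha.set_right _ _ _ (Or.inl rfl), ?_⟩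
  · simp only [Expr.cost, Polynomial.eval_add, Polynomial.eval_C]; omega
  · simp only [Expr.val, State.set_same, not_not]
    rcases hr with ⟨h, hr⟩ | ⟨h, hr⟩ <;> simp [h, hr]

theorem Dec.and (h : Dec d c Q) (h' : Dec d c Q') : Dec d c (fun s => Q s ∧ Q' s) := by
  obtain ⟨hl, P, p, hP⟩ := h
  obtain ⟨hl', P', p', hP'⟩ := h'
  refine ⟨fun s s' h => by simp only [hl s s' h, hl' s s' h],
    .seq P (.ite .res P' .skip), p + p' + Polynomial.C 10, fun s => ?_⟩
  obtain ⟨s', t, he, ht, ha, hr⟩ := hP s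
  rcases hr with ⟨h, hr⟩ | ⟨h, hr⟩
  · obtain ⟨s'', t', he', ht', ha', hr'⟩ := hP' s'
    have hQ : Q' s ↔ Q' s' := by rw [hl' s s' (ha.weaken le_rfl (Or.inl rfl))]
    refine ⟨s'', _, Exec.seq he (Exec.ite_true ?_ he'), ?_, ha.trans ha', ?_⟩
    · simp [Expr.val, hr]
    · rw [← ha.lim (by decide)] at ht'
      simp only [Expr.cost, Polynomial.eval_add, Polynomial.eval_C]; omega
    · simpa [h, hQ] using hr'
  · refine ⟨s', _, Exec.seq he (Exec.ite_false ?_ (Exec.skip _)), ?_, ha, ?_⟩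
    · simp [Expr.val, hr]
    · simp only [Expr.cost, Polynomial.eval_add, Polynomial.eval_C]; omega
    · simp [hr, h]

theorem Dec.or (h : Dec d c Q) (h' : Dec d c Q') : Dec d c (fun s => Q s ∨ Q' s) :=
  (h.not.and h'.not).not.congr fun s => by tauto

theorem Dec.imp (h : Dec d c Q) (h' : Dec d c Q') : Dec d c (fun s => Q s → Q' s) :=
  (h.and h'.not).not.congr fun s => by tauto

theorem Dec.ex (hc : c ≠ 4) (h : Dec (d + 1) c Q) :
    Dec d c (fun s => ∃ a < s 4 0, Q (s.set 2 d a)) := by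
  obtain ⟨hl, P, p, hP⟩ := h
  have hlex : Local d c (fun s => ∃ a < s 4 0, Q (s.set 2 d a)) := by
    intro s s' h
    simp only [h.lim hc]
    have : ∀ a, Q (s.set 2 d a) = Q (s'.set 2 d a) := fun a => hl _ _ (h.set_set a)
    simp only [this]
  refine ⟨hlex, .seq (.write 2 (.const d) (.const 0)) (.seq (.write 3 (.const 0) (.const 0))
    -- The guard is nonzero exactly while no witness has been found and the variable is below the
    -- bound. After a success the variable is left alone and the result register ends the loop.
    (.loop (.sub (.const 1) (.add .res (.sub (.add (.var d) (.const 1)) .lim)))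
      (.seq P (.ite .res .skip (.write 2 (.const d) (.add (.var d) (.const 1))))))),
    (Polynomial.X + Polynomial.C 1) * (p + Polynomial.C 30) + Polynomial.C 30, fun s₀ => ?_⟩
  have key : ∀ m s, s 2 d + m = s 4 0 → s 3 0 = 0 → (∀ a < s 2 d, ¬ Q (s.set 2 d a)) →
      ∃ s' t, Exec (.loop (.sub (.const 1) (.add .res (.sub (.add (.var d) (.const 1)) .lim)))
        (.seq P (.ite .res .skip (.write 2 (.const d) (.add (.var d) (.const 1)))))) s s' t ∧
      t ≤ (m + 1) * (p.eval (s 4 0) + 30) ∧ Agree d 3 s s' ∧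
      ((∃ a < s 4 0, Q (s.set 2 d a)) ∧ s' 3 0 = 1 ∨
        (¬ ∃ a < s 4 0, Q (s.set 2 d a)) ∧ s' 3 0 = 0) := by
    intro m
    induction m with
    | zero =>
      intro s hm hr hn
      refine ⟨s, _, Exec.loop_false ?_, ?_, Agree.refl _ _ _, ?_⟩
      · simp only [Expr.val, hr]; omega
      · simp only [Expr.cost]; omega
      · have : ¬ ∃ a < s 4 0, Q (s.set 2 d a) := by
          rintro ⟨a, ha, hQ⟩
          exact hn a (by omega) hQ
        exact Or.inr ⟨this, hr⟩
    | succ m ih =>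
      intro s hm hr hn
      obtain ⟨s', t, he, ht, ha, hr'⟩ := hP s
      have hv : s 2 d = s' 2 d := ha.var (by decide) (by omega)
      have hN : s 4 0 = s' 4 0 := ha.lim (by decide)
      have hsd : s.set 2 d (s 2 d) = s := by
        funext b i
        by_cases hb : b = 2 ∧ i = d
        · simp [State.set, hb]
        · simp [State.set, hb]
      have hmul : (m + 1 + 1) * (p.eval (s 4 0) + 30) =
        (m + 1) * (p.eval (s 4 0) + 30) + (p.eval (s 4 0) + 30) := by ring
      rcases hr' with ⟨hQ, hr'⟩ | ⟨hQ, hr'⟩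
      · refine ⟨s', _, Exec.loop_true ?_ (Exec.seq he (Exec.ite_true ?_ (Exec.skip _)))
          (Exec.loop_false ?_), ?_, ha.weaken (by omega) (Or.inl rfl), ?_⟩
        · simp only [Expr.val, hr]; omega
        · simp [Expr.val, hr']
        · simp [Expr.val, hr']
        · simp only [Expr.cost]; omega
        · have : ∃ a < s 4 0, Q (s.set 2 d a) := ⟨s 2 d, by omega, by rwa [hsd]⟩
          exact Or.inl ⟨this, hr'⟩
      · have hag : Agree d 3 s (s'.set 2 d (s' 2 d + 1)) :=
          (ha.weaken (by omega) (Or.inl rfl)).set_right _ _ _ (Or.inr (Or.inr ⟨rfl, le_rfl⟩))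
        have hQeq : ∀ a, Q (s.set 2 d a) = Q ((s'.set 2 d (s' 2 d + 1)).set 2 d a) := fun a =>
          hl _ _ ((hag.weaken le_rfl (Or.inl rfl)).set_set a)
        have hN' : (s'.set 2 d (s' 2 d + 1)) 4 0 = s 4 0 := by
          rw [State.set_bank (by decide), hN]
        obtain ⟨s'', t', he', ht', ha', hr''⟩ := ih (s'.set 2 d (s' 2 d + 1))
          (by rw [hN', State.set_same]; omega)
          (by rw [State.set_bank (by decide), hr'])
          (by
            intro a ha
            rw [← hQeq]
            rw [State.set_same] at ha
            rcases Nat.lt_succ_iff_lt_or_eq.mp ha with h | h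
            · exact hn a (by omega)
            · rw [h, ← hv, hsd]; exact hQ)
        refine ⟨s'', _, Exec.loop_true ?_ (Exec.seq he (Exec.ite_false ?_
          (Exec.write _ _ _ _))) he', ?_, hag.trans ha', ?_⟩
        · simp only [Expr.val, hr]; omega
        · simp [Expr.val, hr']
        · rw [hN'] at ht'
          simp only [Expr.cost]; omega
        · rw [hN'] at hr''
          simpa only [hQeq] using hr''
  have hag : Agree d 3 s₀ ((s₀.set 2 d 0).set 3 0 0) :=
    ((Agree.refl _ _ _).set_right _ _ _ (Or.inr (Or.inr ⟨rfl, le_rfl⟩))).set_right _ _ _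
      (Or.inl rfl)
  have hN := hag.lim (by decide)
  have hvd : ((s₀.set 2 d 0).set 3 0 0) 2 d = 0 := by
    rw [State.set_bank (by decide), State.set_same]
  obtain ⟨s', t, he, ht, ha, hr⟩ := key (s₀ 4 0) ((s₀.set 2 d 0).set 3 0 0)
    (by rw [hvd, ← hN]; omega) (by simp) (by rw [hvd]; simp)
  refine ⟨s', _, Exec.seq (Exec.write _ _ _ _) (Exec.seq (Exec.write _ _ _ _) he), ?_,
    hag.trans ha, ?_⟩
  · rw [← hN] at ht
    simp only [Expr.cost, Polynomial.eval_add, Polynomial.eval_mul, Polynomial.eval_X,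
      Polynomial.eval_C]
    omega
  · have := hlex _ _ (hag.weaken (c' := c) le_rfl (Or.inl rfl))
    simp only at this
    simpa only [this] using hr

theorem Dec.all (hc : c ≠ 4) (h : Dec (d + 1) c Q) :
    Dec d c (fun s => ∀ a < s 4 0, Q (s.set 2 d a)) :=
  (h.not.ex hc).not.congr fun s => by push Not; rfl

theorem Dec.false : Dec d c (fun _ => False) :=
  (Dec.atom (local_const 0)).congr fun s => by simp [Expr.val]

theorem Dec.true : Dec d c (fun _ => True) :=
  Dec.false.not.congr fun s => by simp

theorem Dec.existsLt {F : ℕ → State → Prop} (k : ℕ) (h : ∀ j < k, Dec d c (F j)) :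
    Dec d c (fun s => ∃ j < k, F j s) := by
  induction k with
  | zero => exact Dec.false.congr fun s => by simp
  | succ k ih =>
    refine ((ih fun j hj => h j (by omega)).or (h k (by omega))).congr fun s => ?_
    simp only [Nat.lt_succ_iff_lt_or_eq, or_and_right, exists_or, exists_eq_left]

theorem Dec.forallLt {F : ℕ → State → Prop} (k : ℕ) (h : ∀ j < k, Dec d c (F j)) :
    Dec d c (fun s => ∀ j < k, F j s) :=
  (Dec.existsLt k fun j hj => (h j hj).not).not.congr fun s => by push Not; rfl

theorem Dec.eq {e e' : Expr} (he : Local d c (Expr.val · e)) (he' : Local d c (Expr.val · e')) :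
    Dec d c (fun s => e.val s = e'.val s) :=
  -- The sum of the two truncated differences is the distance between the values.
  (Dec.atom (local_add (local_sub he he') (local_sub he' he))).not.congr fun s => by
    simp only [Expr.val]; omega

theorem Dec.lt {e e' : Expr} (he : Local d c (Expr.val · e)) (he' : Local d c (Expr.val · e')) :
    Dec d c (fun s => e.val s < e'.val s) :=
  (Dec.atom (local_sub he' he)).congr fun s => by simp only [Expr.val]; omega

end Dec

/-! ### Simultaneous guarded writes -/

/-- A program can, in polynomial time, perform writes into bank `c` as prescribed by `W`: the
relation `W s i v` says that the value `v` may be written into register `i`. -/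
def Scatter (d c : ℕ) (W : State → ℕ → ℕ → Prop) : Prop :=
  Local d c W ∧ ∃ (P : Program) (p : Polynomial ℕ), ∀ s, ∃ s' t, Exec P s s' t ∧
    t ≤ p.eval (s 4 0) ∧ Agree d c s s' ∧
    ∀ i, W s i (s' c i) ∨ ((∀ v, ¬ W s i v) ∧ s' c i = s c i)

section Scatter

variable {d c : ℕ}

theorem Scatter.write {Q : State → Prop} {e e' : Expr} (hc₂ : c ≠ 2) (hc₃ : c ≠ 3)
    (hQ : Dec d c Q) (he : Local d c (Expr.val · e)) (he' : Local d c (Expr.val · e')) :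
    Scatter d c (fun s i v => Q s ∧ i = e.val s ∧ v = e'.val s) := by
  obtain ⟨hl, P, p, hP⟩ := hQ
  refine ⟨fun s s' h => ?_, .seq P (.ite .res (.write c e e') .skip),
    p + Polynomial.C (e.cost + e'.cost + 10), fun s => ?_⟩
  · have h₁ := he s s' h
    have h₂ := he' s s' h
    simp only at h₁ h₂
    simp only [hl s s' h, h₁, h₂]
  · obtain ⟨s', t, hx, ht, ha, hr⟩ := hP s
    have ha' : Agree d c s s' := ha.weaken le_rfl (Or.inl rfl)
    have h₁ := he s s' ha'
    have h₂ := he' s s' ha'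
    simp only at h₁ h₂
    have hcc : ∀ i, s' c i = s c i := fun i => (ha c i hc₃ hc₃ (fun h => absurd h hc₂)).symm
    rcases hr with ⟨h, hr⟩ | ⟨h, hr⟩
    · refine ⟨_, _, Exec.seq hx (Exec.ite_true ?_ (Exec.write _ _ _ _)), ?_,
        ha'.set_right _ _ _ (Or.inr (Or.inl rfl)), fun i => ?_⟩
      · simp [Expr.val, hr]
      · simp only [Expr.cost, Polynomial.eval_add, Polynomial.eval_C]; omega
      · by_cases hi : i = e.val s
        · left
          rw [h₁] at hi
          rw [hi, State.set_same]
          exact ⟨h, h₁.symm, h₂.symm⟩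
        · right
          rw [State.set_index (by rwa [← h₁])]
          exact ⟨fun v hv => hi hv.2.1, hcc i⟩
    · refine ⟨_, _, Exec.seq hx (Exec.ite_false ?_ (Exec.skip _)), ?_, ha',
        fun i => Or.inr ⟨fun v hv => h hv.1, hcc i⟩⟩
      · simp [Expr.val, hr]
      · simp only [Expr.cost, Polynomial.eval_add, Polynomial.eval_C]; omega

/-- The relation ignores bank `c`, so every round sees the permissions of the original memory in
spite of the earlier writes. A later write may replace an earlier one, but only by another permitted
value. -/
theorem Scatter.loop {W : State → ℕ → ℕ → Prop} (hc₂ : c ≠ 2) (hc₄ : c ≠ 4)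
    (h : Scatter (d + 1) c W) :
    Scatter d c (fun s i v => ∃ a < s 4 0, W (s.set 2 d a) i v) := by
  obtain ⟨hl, P, p, hP⟩ := h
  refine ⟨fun s s' h => ?_, P.for d,
    (Polynomial.X + Polynomial.C 1) * (p + Polynomial.C 12) + Polynomial.C 3, fun s => ?_⟩
  · have : ∀ a, W (s.set 2 d a) = W (s'.set 2 d a) := fun a => hl _ _ (h.set_set a)
    simp only [this, h.lim hc₄]
  · have hstep : ∀ i s₁, i < s 4 0 → (Agree d c s s₁ ∧ s₁ 2 d = i ∧ ∀ x,
        (∃ a < i, W (s.set 2 d a) x (s₁ c x)) ∨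
          ((∀ a < i, ∀ v, ¬ W (s.set 2 d a) x v) ∧ s₁ c x = s c x)) →
        ∃ s₂ t, Exec P s₁ s₂ t ∧ t ≤ p.eval (s 4 0) ∧ s₂ 2 d = i ∧
          (Agree d c s (s₂.set 2 d (i + 1)) ∧ (s₂.set 2 d (i + 1)) 2 d = i + 1 ∧ ∀ x,
          (∃ a < i + 1, W (s.set 2 d a) x ((s₂.set 2 d (i + 1)) c x)) ∨
          ((∀ a < i + 1, ∀ v, ¬ W (s.set 2 d a) x v) ∧
            (s₂.set 2 d (i + 1)) c x = s c x)) := by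
      rintro i s₁ - ⟨ha, hv, hx⟩
      obtain ⟨s₂, t, he, ht, ha', hx'⟩ := hP s₁
      have hW : W s₁ = W (s.set 2 d i) := by
        have := ha.set_eq
        rw [hv] at this
        exact (hl _ _ this).symm
      refine ⟨s₂, t, he, ?_, ?_, ?_, by simp, fun x => ?_⟩
      · rwa [ha.lim hc₄]
      · rw [← hv]; exact (ha'.var hc₂ (by omega)).symm
      · exact (ha.trans (ha'.weaken (by omega) (Or.inr rfl))).set_right _ _ _
          (Or.inr (Or.inr ⟨rfl, le_rfl⟩))
      · rw [State.set_bank hc₂]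
        rw [hW] at hx'
        rcases hx' x with h | ⟨h, hs⟩
        · exact Or.inl ⟨i, by omega, h⟩
        · rw [hs]
          rcases hx x with ⟨a, hai, h'⟩ | ⟨h', hs'⟩
          · exact Or.inl ⟨a, by omega, h'⟩
          · refine Or.inr ⟨fun a ha => ?_, hs'⟩
            rcases Nat.lt_succ_iff_lt_or_eq.mp ha with h₁ | rfl
            · exact h' a h₁
            · exact h
    obtain ⟨s', t, he, ht, ha, -, hx⟩ := exec_for (I := fun i s₁ => Agree d c s s₁ ∧ s₁ 2 d = i ∧
        ∀ x, (∃ a < i, W (s.set 2 d a) x (s₁ c x)) ∨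
          ((∀ a < i, ∀ v, ¬ W (s.set 2 d a) x v) ∧ s₁ c x = s c x))
      (fun i s₁ h => ⟨(h.1.lim hc₄).symm, h.2.1⟩) hstep
      (s := s) ⟨(Agree.refl _ _ _).set_right _ _ _ (Or.inr (Or.inr ⟨rfl, le_rfl⟩)), by simp,
        fun x => Or.inr ⟨by simp, State.set_bank hc₂ _⟩⟩
    refine ⟨s', t, he, ?_, ha, fun x => ?_⟩
    · simpa using ht
    · rcases hx x with h | ⟨h, h'⟩
      · exact Or.inl h
      · exact Or.inr ⟨fun v ⟨a, ha, hW⟩ => h a ha v hW, h'⟩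

/-- The memory `s` after the loop variables `d, …, d + m - 1` have been set to
`x 0, …, x (m - 1)`. -/
def State.setVars (s : State) (d m : ℕ) (x : ℕ → ℕ) : State :=
  fun b i => if b = 2 ∧ d ≤ i ∧ i < d + m then x (i - d) else s b i

theorem State.setVars_succ (s : State) (d m : ℕ) (x : ℕ → ℕ) :
    s.setVars d (m + 1) x = (s.set 2 d (x 0)).setVars (d + 1) m (fun j => x (j + 1)) := by
  funext b i
  by_cases hb : b = 2
  · rcases lt_trichotomy i d with hi | rfl | hi
    · simp only [setVars, set]
      rw [if_neg (by omega), if_neg (by omega), if_neg (by omega)]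
    · simp [setVars, set, hb]
    · have : i - d = i - (d + 1) + 1 := by omega
      simp only [setVars, set, this]
      rw [if_neg (by omega : ¬ (b = 2 ∧ i = d))]
      exact if_congr (by omega) rfl rfl
  · simp [setVars, set, hb]

theorem Scatter.loops {m : ℕ} {W : State → ℕ → ℕ → Prop} (hc₂ : c ≠ 2) (hc₄ : c ≠ 4)
    (h : Scatter (d + m) c W) :
    Scatter d c (fun s i v => ∃ x : ℕ → ℕ, (∀ j < m, x j < s 4 0) ∧
      W (s.setVars d m x) i v) := by
  induction m generalizing d with
  | zero =>
    have : ∀ (s : State) x, s.setVars d 0 x = s := by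
      intro s x
      funext b i
      simp only [State.setVars, ite_eq_right_iff]
      omega
    simpa [this] using h
  | succ m ih =>
    have h' := (ih (d := d + 1) (by rwa [Nat.add_right_comm, Nat.add_assoc])).loop hc₂ hc₄
    convert h' using 5 with s i v
    simp only [State.setVars_succ, State.set_bank (show (4 : ℕ) ≠ 2 by decide)]
    constructor
    · rintro ⟨x, hx, hW⟩
      exact ⟨x 0, hx 0 (by omega), fun j => x (j + 1), fun j hj => hx (j + 1) (by omega), hW⟩
    · rintro ⟨a, ha, x, hx, hW⟩
      refine ⟨fun j => if j = 0 then a else x (j - 1), fun j hj => ?_, by simpa using hW⟩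
      rcases j with _ | j
      · simpa using ha
      · simpa using hx j (by omega)

theorem State.setVars_bank {s : State} {d m b : ℕ} {x : ℕ → ℕ} (hb : b ≠ 2) (i : ℕ) :
    s.setVars d m x b i = s b i := by
  simp [setVars, hb]

theorem State.setVars_lt {s : State} {d m b : ℕ} {x : ℕ → ℕ} {i : ℕ} (hi : i < d) :
    s.setVars d m x b i = s b i := by
  simp only [setVars]
  exact if_neg (by omega)

theorem State.setVars_var {s : State} {d m : ℕ} {x : ℕ → ℕ} {j : ℕ} (hj : j < m) :
    s.setVars d m x 2 (d + j) = x j := by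
  simp [setVars, hj]

end Scatter

end RAM

/-! ### Layerings -/

/-- A layering of a graph: adjacent vertices lie in the same layer or in consecutive layers, and in
every layer with more than one vertex all vertices have a neighbor in the preceding layer. -/
structure IsLayering {V : Type*} (G : SimpleGraph V) (lam : V → ℕ) : Prop where
  pos : ∀ y, lam y ≠ 0
  edge : ∀ y z, G.Adj y z → lam y ≤ lam z + 1
  parent : ∀ t, (∀ y, lam y = t + 1 → ∃ z, lam z = t ∧ G.Adj y z) ∨
    (∀ y y', lam y = t + 1 → lam y' = t + 1 → y = y')

section Layering

variable {n : ℕ} (G : SimpleGraph (Fin n))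

/-- The unassigned vertex `y` enters layer `t + 1`: it has a neighbor in layer `t`, or no
unassigned vertex has one and `y` is the first unassigned vertex. -/
def EntersLayer (t : ℕ) (lam : Fin n → ℕ) (y : Fin n) : Prop :=
  lam y = 0 ∧ ((∃ z, lam z ≠ 0 ∧ lam z = t ∧ G.Adj y z) ∨
    ((∀ u, lam u = 0 → ∀ z, lam z ≠ 0 → lam z = t → ¬ G.Adj u z) ∧ ∀ u < y, lam u ≠ 0))

open Classical in
/-- The layers `1, …, t` of the greedy layering; the other vertices get the value `0`. -/
noncomputable def greedyLayering : ℕ → Fin n → ℕ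
  | 0 => fun _ => 0
  | t + 1 => fun y =>
    if EntersLayer G t (greedyLayering t) y then t + 1 else greedyLayering t y

theorem greedyLayering_le (t : ℕ) (y : Fin n) : greedyLayering G t y ≤ t := by
  induction t with
  | zero => simp [greedyLayering]
  | succ t ih =>
    simp only [greedyLayering]
    split_ifs <;> omega

/-- Only unassigned vertices enter a layer, so assigned values never change and every stage is a
truncation of the later ones. -/
theorem greedyLayering_eq {s t : ℕ} (hst : s ≤ t) (y : Fin n) :
    greedyLayering G s y = if greedyLayering G t y ≤ s then greedyLayering G t y else 0 := by
  induction t, hst using Nat.le_induction with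
  | base => simp [greedyLayering_le]
  | succ t hst ih =>
    rw [ih]
    simp only [greedyLayering]
    by_cases h : EntersLayer G t (greedyLayering G t) y
    · simp only [h, if_true]
      rw [h.1]
      simp
      omega
    · simp [h]

/-- Every round before completion assigns some vertex: one with a neighbor in the last layer or,
failing that, the first unassigned one. Hence `n` rounds suffice. -/
theorem le_card_greedyLayering (t : ℕ) (h : ∃ y, greedyLayering G t y = 0) :
    t ≤ (Finset.univ.filter fun y => greedyLayering G t y ≠ 0).card := by
  induction t with
  | zero => simp
  | succ t ih =>
    obtain ⟨y, hy⟩ := h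
    have hmono : ∀ y, greedyLayering G t y ≠ 0 →
        greedyLayering G (t + 1) y = greedyLayering G t y := by
      intro y hy
      simp only [greedyLayering]
      exact if_neg fun h => hy h.1
    have hy' : greedyLayering G t y = 0 := by
      by_contra h
      exact h (by rw [← hmono y h, hy])
    obtain ⟨x, hx⟩ : ∃ x, EntersLayer G t (greedyLayering G t) x := by
      by_cases h : ∃ u, greedyLayering G t u = 0 ∧
          ∃ z, greedyLayering G t z ≠ 0 ∧ greedyLayering G t z = t ∧ G.Adj u z
      · obtain ⟨u, hu, h⟩ := h
        exact ⟨u, hu, Or.inl h⟩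
      · push Not at h
        have hex : (Finset.univ.filter fun u => greedyLayering G t u = 0).Nonempty :=
          ⟨y, by simpa using hy'⟩
        have hm := Finset.min'_mem _ hex
        refine ⟨Finset.min' _ hex, by simpa using hm, Or.inr ⟨fun u hu z h₁ h₂ => h u hu z h₁ h₂,
          fun u hu h0 => ?_⟩⟩
        exact absurd (Finset.min'_le _ u (by simpa using h0)) (not_le.mpr hu)
    have hxt : greedyLayering G (t + 1) x = t + 1 := by
      simp only [greedyLayering]
      exact if_pos hx
    refine Nat.lt_of_le_of_lt (ih ⟨y, hy'⟩) (Finset.card_lt_card ?_)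
    refine Finset.ssubset_iff_subset_ne.mpr ⟨fun u hu => ?_, fun h => ?_⟩
    · simp only [Finset.mem_filter, Finset.mem_univ, true_and] at hu ⊢
      rwa [hmono u hu]
    · have : x ∈ Finset.univ.filter fun y => greedyLayering G t y ≠ 0 := by
        rw [h]; simp [hxt]
      simp [hx.1] at this

theorem greedyLayering_ne_zero {t : ℕ} (ht : n ≤ t) (y : Fin n) : greedyLayering G t y ≠ 0 := by
  intro h
  have h₁ := le_card_greedyLayering G t ⟨y, h⟩
  have h₂ : (Finset.univ.filter fun y => greedyLayering G t y ≠ 0).card <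
      (Finset.univ : Finset (Fin n)).card := by
    refine Finset.card_lt_card (Finset.ssubset_iff_subset_ne.mpr ⟨Finset.filter_subset _ _, ?_⟩)
    intro h'
    have := h' ▸ Finset.mem_univ y
    simp [h] at this
  rw [Finset.card_univ, Fintype.card_fin] at h₂
  omega

theorem greedyLayering_le_card {t : ℕ} (ht : n ≤ t) (y : Fin n) : greedyLayering G t y ≤ n := by
  have h := greedyLayering_eq G ht y
  by_contra h'
  rw [if_neg h'] at h
  exact greedyLayering_ne_zero G le_rfl y h

theorem entersLayer_greedyLayering {t T : ℕ} (hT : t + 1 ≤ T) (y : Fin n) :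
    EntersLayer G t (greedyLayering G t) y ↔ greedyLayering G T y = t + 1 := by
  have h := greedyLayering_eq G hT y
  have hle := greedyLayering_le G t y
  simp only [greedyLayering] at h
  split_ifs at h with h₁ h₂ h₂ <;> simp only [h₁, true_iff, false_iff] <;> omega

/-- If `y` were more than one layer after its neighbor `z`, it would have been unassigned when the
layer of `z` was complete, and would have entered the next one. Within a round the two ways of
entering exclude each other, and the second admits only the least unassigned vertex. -/
theorem isLayering_greedyLayering {T : ℕ} (hT : n ≤ T) : IsLayering G (greedyLayering G T) where
  pos := greedyLayering_ne_zero G hT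
  edge y z h := by
    by_contra hlt
    have hz := greedyLayering_ne_zero G hT z
    have hy := greedyLayering_le G T y
    have h₁ : EntersLayer G (greedyLayering G T z) (greedyLayering G (greedyLayering G T z)) y := by
      have hs : greedyLayering G T z ≤ T := greedyLayering_le G T z
      refine ⟨?_, Or.inl ⟨z, ?_, ?_, h⟩⟩
      · rw [greedyLayering_eq G hs y]
        exact if_neg (by omega)
      · rw [greedyLayering_eq G hs z]
        simpa using hz
      · rw [greedyLayering_eq G hs z]
        simp
    rw [entersLayer_greedyLayering G (T := T) (by omega)] at h₁
    omega
  parent t := by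
    by_cases ht : t + 1 ≤ T
    · by_cases h : ∃ u, greedyLayering G t u = 0 ∧
          ∃ z, greedyLayering G t z ≠ 0 ∧ greedyLayering G t z = t ∧ G.Adj u z
      · left
        intro y hy
        rw [← entersLayer_greedyLayering G ht] at hy
        obtain ⟨u, hu, z, hz, hzt, huz⟩ := h
        rcases hy with ⟨-, ⟨z, hz, hzt, hyz⟩ | ⟨h, -⟩⟩
        · refine ⟨z, ?_, hyz⟩
          have := greedyLayering_eq G (show t ≤ T by omega) z
          split_ifs at this <;> omega
        · exact absurd huz (h u hu z hz hzt)
      · right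
        push Not at h
        have key : ∀ y, greedyLayering G T y = t + 1 →
            greedyLayering G t y = 0 ∧ ∀ u < y, greedyLayering G t u ≠ 0 := by
          intro y hy
          rw [← entersLayer_greedyLayering G ht] at hy
          rcases hy with ⟨hy, ⟨z, hz, hzt, hyz⟩ | ⟨-, h'⟩⟩
          · exact absurd hyz (h y hy z hz hzt)
          · exact ⟨hy, h'⟩
        intro y y' hy hy'
        rcases lt_trichotomy y y' with hlt | heq | hlt
        · exact absurd (key y hy).1 ((key y' hy').2 y hlt)
        · exact heq
        · exact absurd (key y' hy').1 ((key y hy).2 y' hlt)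
    · right
      intro y _ hy
      have := greedyLayering_le G T y
      omega

end Layering

/-! ### Permutation graphs -/

/-- Two segments between the parallel lines are disjoint if and only if one of them lies to the
left of the other. -/
theorem diagramSegment_inter_nonempty_iff (a b a' b' : ℝ) :
    (diagramSegment a b ∩ diagramSegment a' b').Nonempty ↔
      ¬ (a < a' ∧ b < b') ∧ ¬ (a' < a ∧ b' < b) := by
  have hmem : ∀ (a b : ℝ) (x : ℝ × ℝ), x ∈ diagramSegment a b ↔
      0 ≤ x.2 ∧ x.2 ≤ 1 ∧ x.1 = (1 - x.2) * a + x.2 * b := by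
    intro a b x
    constructor
    · rintro ⟨u, v, hu, hv, huv, rfl⟩
      simp only [Prod.smul_mk, Prod.mk_add_mk, smul_eq_mul, mul_zero, mul_one, zero_add]
      refine ⟨hv, by linarith, ?_⟩
      rw [← huv]; ring
    · rintro ⟨h₀, h₁, h⟩
      refine ⟨1 - x.2, x.2, by linarith, h₀, by ring, ?_⟩
      ext <;> simp [h]
  constructor
  · rintro ⟨x, hx, hx'⟩
    rw [hmem] at hx hx'
    obtain ⟨h₀, h₁, h⟩ := hx
    obtain ⟨-, -, h'⟩ := hx'
    rw [h] at h'
    -- A convex combination of positive gaps is positive, so ordered segments never meet at a common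
    -- height.
    have key : ∀ c d : ℝ, 0 < c → 0 < d → 0 < (1 - x.2) * c + x.2 * d := by
      intro c d hc hd
      rcases h₀.eq_or_lt with h | h
      · simpa [← h] using hc
      · have := mul_nonneg (sub_nonneg.mpr h₁) hc.le
        have := mul_pos h hd
        linarith
    constructor
    · rintro ⟨hp, hq⟩
      have := key (a' - a) (b' - b) (by linarith) (by linarith)
      linarith
    · rintro ⟨hp, hq⟩
      have := key (a - a') (b - b') (by linarith) (by linarith)
      linarith
  · rintro ⟨h₁, h₂⟩
    -- The horizontal gap at height `s` is continuous in `s`. It changes sign between the two lines,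
    -- except when the segments share their endpoint on the lower line.
    obtain ⟨s, hs₀, hs₁, hs⟩ : ∃ s : ℝ, 0 ≤ s ∧ s ≤ 1 ∧ (1 - s) * (a - a') + s * (b - b') = 0 := by
      have hcont : ContinuousOn (fun s : ℝ => (1 - s) * (a - a') + s * (b - b')) (Set.Icc 0 1) := by
        fun_prop
      by_cases ha : a ≤ a'
      · by_cases hb : b' ≤ b
        · obtain ⟨s, hs, h⟩ := intermediate_value_Icc zero_le_one hcont
            (show (0 : ℝ) ∈ Set.Icc _ _ by constructor <;> simp <;> assumption)
          exact ⟨s, hs.1, hs.2, h⟩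
        · have : a = a' := by
            by_contra hne
            exact h₁ ⟨lt_of_le_of_ne ha hne, not_le.mp hb⟩
          exact ⟨0, le_rfl, zero_le_one, by rw [this]; ring⟩
      · have hb : b ≤ b' := by
          by_contra hb
          exact h₂ ⟨not_le.mp ha, not_le.mp hb⟩
        obtain ⟨s, hs, h⟩ := intermediate_value_Icc' zero_le_one hcont
          (show (0 : ℝ) ∈ Set.Icc _ _ by constructor <;> simp <;> linarith)
        exact ⟨s, hs.1, hs.2, h⟩
    refine ⟨((1 - s) * a + s * b, s), (hmem _ _ _).mpr ⟨hs₀, hs₁, rfl⟩,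
      (hmem _ _ _).mpr ⟨hs₀, hs₁, ?_⟩⟩
    simp only
    linarith

section PermutationGraph

variable {V : Type*} {G : SimpleGraph V} {p q : V → ℝ}

/-- Distinct vertices are adjacent if and only if they are incomparable in the product of the
orders given by `p` and `q`. -/
def IsDiagram (G : SimpleGraph V) (p q : V → ℝ) : Prop :=
  ∀ u v, u ≠ v → (G.Adj u v ↔ ¬ (p u < p v ∧ q u < q v) ∧ ¬ (p v < p u ∧ q v < q u))

theorem IsPermutationGraph.exists_isDiagram (h : IsPermutationGraph G) :
    ∃ p q : V → ℝ, IsDiagram G p q := by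
  obtain ⟨p, q, h⟩ := h
  exact ⟨p, q, fun u v huv => by rw [h u v huv, diagramSegment_inter_nonempty_iff]⟩

/-- Reversing both lines exchanges left and right, which yields the mirror images of the lemmas
below. -/
theorem IsDiagram.neg (h : IsDiagram G p q) : IsDiagram G (-p) (-q) := by
  intro u v huv
  rw [h u v huv]
  simp only [Pi.neg_apply, neg_lt_neg_iff]
  tauto

/-- If `y` lies to the left of `w`, then it lies to the left of every neighbor `u` of `w` that is
distinct from `y` and not adjacent to `y`. -/
theorem IsDiagram.left_of_adj (h : IsDiagram G p q) {y w u : V} (hyw : p y < p w ∧ q y < q w)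
    (hwu : G.Adj w u) (hyu : y ≠ u) (hn : ¬ G.Adj y u) : p y < p u ∧ q y < q u := by
  rw [h y u hyu] at hn
  have hwu' := (h w u hwu.ne).mp hwu
  by_contra hc
  have : p u < p y ∧ q u < q y := by tauto
  exact hwu'.2 ⟨this.1.trans hyw.1, this.2.trans hyw.2⟩

/-- If `y` missed both `a` and `b`, it would lie to the left of each by `left_of_adj`. The
minimality of `p a` and of `q b` would then put it to the left of all of `S`, including its neighbor
`z`. -/
theorem IsDiagram.adj_extreme (h : IsDiagram G p q) {S : Set V} {y a b z : V} (hyS : y ∉ S)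
    (hw : ∀ x ∈ S, ∃ w, G.Adj x w ∧ p y < p w ∧ q y < q w) (ha : a ∈ S) (hb : b ∈ S)
    (hpa : ∀ x ∈ S, p a ≤ p x) (hqb : ∀ x ∈ S, q b ≤ q x) (hz : z ∈ S) (hyz : G.Adj y z) :
    G.Adj y a ∨ G.Adj y b := by
  have hne : ∀ x ∈ S, y ≠ x := fun x hx hyx => hyS (hyx ▸ hx)
  have hyz' := ((h y z hyz.ne).mp hyz).1
  by_contra hc
  push Not at hc
  obtain ⟨w, haw, hw₁⟩ := hw a ha
  obtain ⟨w', hbw, hw₂⟩ := hw b hb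
  have h₁ := h.left_of_adj hw₁ haw.symm (hne a ha) hc.1
  have h₂ := h.left_of_adj hw₂ hbw.symm (hne b hb) hc.2
  exact hyz' ⟨h₁.1.trans_le (hpa z hz), h₂.2.trans_le (hqb z hz)⟩

/-- Trace `w` and `w'` back through preceding layers, at the latest to a layer with one vertex. All
vertices on the way are non-neighbors of `y`, so `left_of_adj` carries the side of `y` back from `w`
and forward again to `w'`. -/
theorem IsDiagram.left_of_layer (h : IsDiagram G p q) {lam : V → ℕ} (hl : IsLayering G lam)
    {y : V} {s : ℕ} (hs : s + 2 ≤ lam y) {w w' : V} (hw : lam w = s) (hw' : lam w' = s)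
    (hyw : p y < p w ∧ q y < q w) : p y < p w' ∧ q y < q w' := by
  have hn : ∀ u, lam u + 2 ≤ lam y → y ≠ u ∧ ¬ G.Adj y u := by
    intro u hu
    refine ⟨fun h => ?_, fun h => ?_⟩
    · rw [h] at hu; omega
    · have := hl.edge y u h
      omega
  induction s generalizing w w' with
  | zero => exact absurd hw (hl.pos w)
  | succ s ih =>
    rcases hl.parent s with hp | hp
    · obtain ⟨u, hu, hwu⟩ := hp w hw
      obtain ⟨u', hu', hwu'⟩ := hp w' hw'
      obtain ⟨h₁, h₂⟩ := hn u (by omega)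
      obtain ⟨h₁', h₂'⟩ := hn w' (by omega)
      exact h.left_of_adj (ih (by omega) hu hu' (h.left_of_adj hyw hwu h₁ h₂)) hwu'.symm h₁' h₂'
    · rwa [← hp w w' hw hw']

/-- If the layer or the preceding one is a singleton, its vertex dominates. Otherwise the dominators
are the vertices of the preceding layer with least and greatest endpoints on each line. Two of them
serve the vertices to the left of the layer before that, the other two those to the right. -/
theorem IsDiagram.exists_dominating [Fintype V] [DecidableEq V] (h : IsDiagram G p q)
    {lam : V → ℕ} (hl : IsLayering G lam) (t : ℕ) :
    ∃ D : Finset V, D.card ≤ 4 ∧ ∀ y, lam y = t → y ∈ D ∨ ∃ d ∈ D, G.Adj y d := by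
  by_cases hne : ∃ y, lam y = t
  swap
  · exact ⟨∅, by simp, fun y hy => absurd ⟨y, hy⟩ hne⟩
  obtain ⟨y₀, hy₀⟩ := hne
  obtain ⟨t, rfl⟩ : ∃ t', t = t' + 1 := Nat.exists_eq_succ_of_ne_zero (hy₀ ▸ hl.pos y₀)
  rcases hl.parent t with hp | hp
  swap
  · exact ⟨{y₀}, by simp, fun y hy => Or.inl (by simpa using hp y y₀ hy hy₀)⟩
  obtain ⟨z₀, hz₀, -⟩ := hp y₀ hy₀
  obtain ⟨t, rfl⟩ : ∃ t', t = t' + 1 := Nat.exists_eq_succ_of_ne_zero (hz₀ ▸ hl.pos z₀)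
  rcases hl.parent t with hp' | hp'
  swap
  · refine ⟨{z₀}, by simp, fun y hy => Or.inr ⟨z₀, by simp, ?_⟩⟩
    obtain ⟨z, hz, hyz⟩ := hp y hy
    rwa [← hp' z z₀ hz hz₀]
  have hS : (Finset.univ.filter fun x => lam x = t + 1).Nonempty := ⟨z₀, by simpa using hz₀⟩
  obtain ⟨a, ha, hpa⟩ := Finset.exists_min_image _ p hS
  obtain ⟨b, hb, hqb⟩ := Finset.exists_min_image _ q hS
  obtain ⟨a', ha', hpa'⟩ := Finset.exists_min_image _ (-p) hS
  obtain ⟨b', hb', hqb'⟩ := Finset.exists_min_image _ (-q) hS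
  simp only [Finset.mem_filter, Finset.mem_univ, true_and] at ha hb ha' hb' hpa hqb hpa' hqb'
  refine ⟨{a, b, a', b'}, Finset.card_le_four, fun y hy => Or.inr ?_⟩
  obtain ⟨z, hz, hyz⟩ := hp y hy
  obtain ⟨w₀, hw₀, hzw₀⟩ := hp' z hz
  have hyS : y ∉ {x | lam x = t + 1} := by simp [hy]
  have hyw₀ : y ≠ w₀ := by
    rintro rfl
    omega
  have hn : ¬ G.Adj y w₀ := fun h => by
    have := hl.edge _ _ h
    omega
  -- Being non-adjacent, `y` and `w₀` are comparable, and this decides on which side of `y` the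
  -- whole layer of `w₀` lies.
  rw [h y w₀ hyw₀] at hn
  by_cases hlt : p y < p w₀ ∧ q y < q w₀
  · have := h.adj_extreme (S := {x | lam x = t + 1}) hyS
      (fun x hx => by
        obtain ⟨w, hw, hxw⟩ := hp' x hx
        exact ⟨w, hxw, h.left_of_layer hl (by omega) hw₀ hw hlt⟩) ha hb hpa hqb hz hyz
    rcases this with h | h
    · exact ⟨a, by simp, h⟩
    · exact ⟨b, by simp, h⟩
  · have hlt' : (-p) y < (-p) w₀ ∧ (-q) y < (-q) w₀ := by
      simp only [Pi.neg_apply, neg_lt_neg_iff]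
      tauto
    have := h.neg.adj_extreme (S := {x | lam x = t + 1}) hyS
      (fun x hx => by
        obtain ⟨w, hw, hxw⟩ := hp' x hx
        exact ⟨w, hxw, h.neg.left_of_layer hl (by omega) hw₀ hw hlt'⟩) ha' hb' hpa' hqb' hz hyz
    rcases this with h | h
    · exact ⟨a', by simp, h⟩
    · exact ⟨b', by simp, h⟩

end PermutationGraph

/-- If the layers of a layering can be dominated by few vertices, then a `2`-rainbow function of
minimum cost has bounded weight in every layer. -/
theorem IsLayering.weight_le {V : Type*} [Fintype V] [DecidableEq V] {G : SimpleGraph V}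
    {lam : V → ℕ} (hl : IsLayering G lam) {m : ℕ}
    (hD : ∀ t, ∃ D : Finset V, D.card ≤ m ∧ ∀ y, lam y = t → y ∈ D ∨ ∃ d ∈ D, G.Adj y d)
    {f : V → Finset (Fin 2)} (hf : IsRainbowFunction 2 G f)
    (hmin : rainbowCost f = rainbowDominationNumber 2 G) {t : ℕ} :
    ∑ y with lam y = t, (f y).card ≤ 6 * m := by
  choose D hDm hD using hD
  -- Three layers are needed: erasing the labels of layer `t` can harm only vertices in the layers
  -- `t - 1`, `t` and `t + 1`.
  set E : Finset V := D (t - 1) ∪ D t ∪ D (t + 1) with hE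
  have hEm : E.card ≤ 3 * m := by
    have h₁ := Finset.card_union_le (D (t - 1) ∪ D t) (D (t + 1))
    have h₂ := Finset.card_union_le (D (t - 1)) (D t)
    rw [← hE] at h₁
    have := hDm (t - 1)
    have := hDm t
    have := hDm (t + 1)
    omega
  set g : V → Finset (Fin 2) := fun y =>
    if y ∈ E then Finset.univ else if lam y = t then ∅ else f y with hg
  have hgr : IsRainbowFunction 2 G g := by
    intro y hy c
    have hyE : y ∉ E := by
      intro h
      have : c ∈ g y := by simp [hg, h]
      simp [hy] at this
    simp only [hE, Finset.mem_union, not_or] at hyE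
    by_cases hc : lam y = t - 1 ∨ lam y = t ∨ lam y = t + 1
    · have : ∃ d ∈ E, G.Adj y d := by
        rcases hc with h | h | h
        · obtain ⟨d, hd, hyd⟩ := (hD _ y h).resolve_left hyE.1.1
          exact ⟨d, by simp [hE, hd], hyd⟩
        · obtain ⟨d, hd, hyd⟩ := (hD _ y h).resolve_left hyE.1.2
          exact ⟨d, by simp [hE, hd], hyd⟩
        · obtain ⟨d, hd, hyd⟩ := (hD _ y h).resolve_left hyE.2
          exact ⟨d, by simp [hE, hd], hyd⟩
      obtain ⟨d, hd, hyd⟩ := this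
      exact ⟨d, hyd, by simp [hg, hd]⟩
    -- Here `y` has no neighbor in layer `t`, so the neighbor that supplies the color `c` keeps it.
    · push Not at hc
      have hfy : f y = ∅ := by
        have : y ∉ E := by simp [hE, hyE]
        simpa [hg, this, hc.2.1] using hy
      obtain ⟨z, hyz, hz⟩ := hf y hfy c
      refine ⟨z, hyz, ?_⟩
      have h₁ := hl.edge _ _ hyz
      have h₂ := hl.edge _ _ hyz.symm
      simp only [hg]
      split_ifs with h h'
      · simp
      · omega
      · exact hz
  have hle : rainbowCost f ≤ rainbowCost g := by
    rw [hmin]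
    exact (rainbowDominationNumber_isLeast 2 G).2 ⟨g, hgr, rfl⟩
  have hsum : rainbowCost g ≤ 2 * E.card + ∑ y with ¬ lam y = t, (f y).card := by
    have : ∀ y, (g y).card ≤ (if y ∈ E then 2 else 0) + if ¬ lam y = t then (f y).card else 0 := by
      intro y
      simp only [hg]
      by_cases h₁ : y ∈ E <;> by_cases h₂ : lam y = t <;> simp [h₁, h₂]
    refine (Finset.sum_le_sum fun y _ => this y).trans ?_
    rw [Finset.sum_add_distrib, ← Finset.sum_filter, ← Finset.sum_filter]
    simp [mul_comm]
  have hsplit := Finset.sum_filter_add_sum_filter_not Finset.univ (fun y => lam y = t)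
    fun y => (f y).card
  simp only [rainbowCost] at hle hsum
  omega

/-! ### The dynamic program -/

section DynamicProgram

variable {n : ℕ}

/-- Labels are encoded by positive numbers: the color `c` at the vertex `v`. -/
def labelCode (n v c : ℕ) : ℕ := v + 1 + c * n

theorem labelCode_inj {v w c d : ℕ} (hv : v < n) (hw : w < n) (hc : c < 2) (hd : d < 2)
    (h : labelCode n v c = labelCode n w d) : v = w ∧ c = d := by
  simp only [labelCode] at h
  interval_cases c <;> interval_cases d <;> omega

/-- The block of `k` entries of `u` that starts at position `a` contains the label `(v, c)`. -/
def BlockHas (n k a : ℕ) (u : ℕ → ℕ) (v c : ℕ) : Prop := ∃ j < k, u (a + j) = labelCode n v c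

/-- The number of nonzero entries of a block. -/
def blockWeight (k a : ℕ) (u : ℕ → ℕ) : ℕ := ∑ j ∈ Finset.range k, (1 - (1 - u (a + j)))

theorem blockWeight_eq (k a : ℕ) (u : ℕ → ℕ) :
    blockWeight k a u = ((Finset.range k).filter fun j => u (a + j) ≠ 0).card := by
  rw [blockWeight, Finset.card_filter]
  refine Finset.sum_congr rfl fun j _ => ?_
  split_ifs <;> omega

/-- The vertices of layer `t` are dominated by the labels in the first, second and fourth part of
`u`. -/
def LayerDominated (k : ℕ) (G : SimpleGraph (Fin n)) (lam : Fin n → ℕ) (t : ℕ) (u : ℕ → ℕ) :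
    Prop :=
  ∀ y, lam y = t → (∃ c < 2, BlockHas n k k u y c) ∨ ∀ c < 2, ∃ z, G.Adj y z ∧
    (BlockHas n k 0 u z c ∨ BlockHas n k k u z c ∨ BlockHas n k (2 * k + 1) u z c)

/-- The configurations that can be reached in `t` steps. A configuration consists of the labels of
layer `t - 1`, the labels of layer `t`, and the cost of all labels so far. A step appends the labels
of layer `t + 1`. -/
def Reachable (k : ℕ) (G : SimpleGraph (Fin n)) (lam : Fin n → ℕ) : ℕ → (ℕ → ℕ) → Prop
  | 0, x => ∀ j < 2 * k + 1, x j = 0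
  | t + 1, x => ∃ u : ℕ → ℕ, (∀ j < 3 * k + 1, u j < 2 * n + 2) ∧ Reachable k G lam t u ∧
      u (2 * k) + blockWeight k (2 * k + 1) u < 2 * n + 2 ∧ LayerDominated k G lam t u ∧
      (∀ j < k, x j = u (k + j)) ∧ (∀ j < k, x (k + j) = u (2 * k + 1 + j)) ∧
      x (2 * k) = u (2 * k) + blockWeight k (2 * k + 1) u

variable {k : ℕ} {G : SimpleGraph (Fin n)} {lam : Fin n → ℕ}

theorem Reachable.congr {t : ℕ} {x x' : ℕ → ℕ} (h : Reachable k G lam t x)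
    (hx : ∀ j < 2 * k + 1, x j = x' j) : Reachable k G lam t x' := by
  cases t with
  | zero => exact fun j hj => by rw [← hx j hj]; exact h j hj
  | succ t =>
    obtain ⟨u, h₁, h₂, h₃, h₄, h₅, h₆, h₇⟩ := h
    refine ⟨u, h₁, h₂, h₃, h₄, fun j hj => ?_, fun j hj => ?_, ?_⟩
    · rw [← hx j (by omega), h₅ j hj]
    · rw [← hx _ (by omega), h₆ j hj]
    · rw [← hx _ (by omega), h₇]

/-! ### Soundness: reachable configurations yield labelings -/

open Classical in
-- Distinct labels have distinct nonzero codes, so each label that occurs has an entry of its own.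
-- Repeated or meaningless entries only increase the weight.
theorem sum_card_blockHas_le (k a : ℕ) (u : ℕ → ℕ) :
    ∑ v : Fin n, (Finset.univ.filter fun c : Fin 2 => BlockHas n k a u v c).card ≤
      blockWeight k a u := by
  rw [blockWeight_eq, ← Finset.card_sigma]
  have hinj : Set.InjOn (fun x : Σ _ : Fin n, Fin 2 => labelCode n x.1 x.2)
      (Finset.univ.sigma fun v : Fin n =>
        Finset.univ.filter fun c : Fin 2 => BlockHas n k a u v c) := by
    rintro ⟨v, c⟩ - ⟨w, d⟩ - h
    obtain ⟨h₁, h₂⟩ := labelCode_inj v.2 w.2 c.2 d.2 h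
    simp [Fin.ext h₁, Fin.ext h₂]
  rw [← Finset.card_image_of_injOn hinj]
  refine (Finset.card_le_card ?_).trans
    (Finset.card_image_le (s := (Finset.range k).filter fun j => u (a + j) ≠ 0)
      (f := fun j => u (a + j)))
  intro l hl
  simp only [Finset.mem_image, Finset.mem_sigma, Finset.mem_univ, true_and, Finset.mem_filter,
    Finset.mem_range] at hl ⊢
  obtain ⟨x, ⟨j, hj, hx⟩, rfl⟩ := hl
  exact ⟨j, ⟨hj, by rw [hx, labelCode]; omega⟩, hx⟩

/-- The labeling collects all labels appended along the way. Nothing forces a label to belong to the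
layer of its block: a misplaced or repeated label is still paid for, so the recorded cost remains an
upper bound. Layer `t` is tested in the step that appends the block for layer `t + 1`. -/
theorem Reachable.exists_labeling {t : ℕ} {x : ℕ → ℕ} (h : Reachable k G lam t x) :
    ∃ f : Fin n → Finset (Fin 2), rainbowCost f ≤ x (2 * k) ∧
      (∀ (v : Fin n) (c : Fin 2), BlockHas n k 0 x v c ∨ BlockHas n k k x v c → c ∈ f v) ∧
      ∀ y, lam y < t → f y = ∅ → ∀ c : Fin 2, ∃ z, G.Adj y z ∧ c ∈ f z := by
  classical
  induction t generalizing x with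
  | zero =>
    refine ⟨fun _ => ∅, by simp [rainbowCost], fun v c hx => ?_, fun y hy => absurd hy (by simp)⟩
    have key : ∀ j < 2 * k + 1, x j ≠ labelCode n v c := fun j hj => by
      rw [h j hj, labelCode]; omega
    rcases hx with ⟨j, hj, hx⟩ | ⟨j, hj, hx⟩
    · exact absurd hx (key _ (by omega))
    · exact absurd hx (key _ (by omega))
  | succ t ih =>
    obtain ⟨u, -, hu, -, hd, h₁, h₂, h₃⟩ := h
    obtain ⟨f, hf₁, hf₂, hf₃⟩ := ih hu
    refine ⟨fun v => f v ∪ Finset.univ.filter fun c : Fin 2 => BlockHas n k (2 * k + 1) u v c,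
      ?_, ?_, ?_⟩
    · rw [h₃]
      refine le_trans ?_ (Nat.add_le_add hf₁ (sum_card_blockHas_le (n := n) k (2 * k + 1) u))
      simp only [rainbowCost]
      rw [← Finset.sum_add_distrib]
      exact Finset.sum_le_sum fun v _ => Finset.card_union_le _ _
    · rintro v c (⟨j, hj, hx⟩ | ⟨j, hj, hx⟩)
      · refine Finset.mem_union_left _ (hf₂ v c (Or.inr ⟨j, hj, ?_⟩))
        rw [← h₁ j hj, ← hx, Nat.zero_add]
      · refine Finset.mem_union_right _ ?_
        simp only [Finset.mem_filter, Finset.mem_univ, true_and]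
        exact ⟨j, hj, by rw [← h₂ j hj, ← hx]⟩
    · intro y hy hfy c
      rw [Finset.union_eq_empty] at hfy
      rcases Nat.lt_succ_iff_lt_or_eq.mp hy with hy | hy
      · obtain ⟨z, hyz, hz⟩ := hf₃ y hy hfy.1 c
        exact ⟨z, hyz, Finset.mem_union_left _ hz⟩
      · rcases hd y hy with ⟨d, hd, hb⟩ | hd
        · have := hf₂ y ⟨d, hd⟩ (Or.inr hb)
          simp [hfy.1] at this
        · obtain ⟨z, hyz, hz⟩ := hd c c.2
          refine ⟨z, hyz, ?_⟩
          rcases hz with hz | hz | hz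
          · exact Finset.mem_union_left _ (hf₂ z c (Or.inl hz))
          · exact Finset.mem_union_left _ (hf₂ z c (Or.inr hz))
          · exact Finset.mem_union_right _ (by simpa using hz)

/-! ### Completeness: light rainbow functions yield reachable configurations -/

/-- A finite set of positive numbers with at most `k` elements, as a block of `k` entries. -/
theorem exists_block (k : ℕ) (F : Finset ℕ) (hF : F.card ≤ k) (h0 : 0 ∉ F) :
    ∃ a : ℕ → ℕ, (∀ j, a j = 0 ∨ a j ∈ F) ∧ (∀ l ∈ F, ∃ j < k, a j = l) ∧
      ((Finset.range k).filter fun j => a j ≠ 0).card = F.card := by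
  have hget : ∀ j, j < F.card → F.toList.getD j 0 ∈ F := by
    intro j hj
    have hj' : j < F.toList.length := by simpa using hj
    rw [List.getD_eq_getElem _ _ hj', ← Finset.mem_toList]
    exact List.getElem_mem hj'
  have hnot : ∀ j, ¬ j < F.card → F.toList.getD j 0 = 0 := by
    intro j hj
    exact List.getD_eq_default _ _ (by simpa using hj)
  refine ⟨fun j => F.toList.getD j 0, fun j => ?_, fun l hl => ?_, ?_⟩
  · by_cases hj : j < F.card
    · exact Or.inr (hget j hj)
    · exact Or.inl (hnot j hj)
  · obtain ⟨j, hj, rfl⟩ := List.getElem_of_mem (Finset.mem_toList.mpr hl)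
    refine ⟨j, lt_of_lt_of_le (by simpa using hj) hF, List.getD_eq_getElem _ _ hj⟩
  · have : ((Finset.range k).filter fun j => F.toList.getD j 0 ≠ 0) = Finset.range F.card := by
      ext j
      simp only [Finset.mem_filter, Finset.mem_range]
      constructor
      · rintro ⟨-, h⟩
        by_contra hj
        exact h (hnot j hj)
      · exact fun hj => ⟨by omega, fun h => h0 (h ▸ hget j hj)⟩
    rw [this, Finset.card_range]

theorem exists_layer_block (f : Fin n → Finset (Fin 2)) (t : ℕ)
    (hk : ∑ y with lam y = t, (f y).card ≤ k) :
    ∃ a : ℕ → ℕ, (∀ j, a j < 2 * n + 2) ∧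
      (∀ (v : Fin n) (c : Fin 2), lam v = t → c ∈ f v → ∃ j < k, a j = labelCode n v c) ∧
      ((∀ v, lam v ≠ t) → ∀ j, a j = 0) ∧
      ((Finset.range k).filter fun j => a j ≠ 0).card = ∑ y with lam y = t, (f y).card := by
  set S : Finset (Σ _ : Fin n, Fin 2) := (Finset.univ.filter fun y => lam y = t).sigma f with hS
  set F : Finset ℕ := S.image (fun x => labelCode n x.1 x.2) with hF
  have hcard : F.card = ∑ y with lam y = t, (f y).card := by
    rw [hF, Finset.card_image_of_injOn, hS, Finset.card_sigma]
    rintro ⟨v, c⟩ - ⟨w, d⟩ - h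
    obtain ⟨h₁, h₂⟩ := labelCode_inj v.2 w.2 c.2 d.2 h
    simp [Fin.ext h₁, Fin.ext h₂]
  obtain ⟨a, ha, hF', hw⟩ := exists_block k F (hcard ▸ hk) (by
    simp only [hF, Finset.mem_image, not_exists, not_and]
    rintro x - h
    simp [labelCode] at h)
  refine ⟨a, fun j => ?_, fun v c hv hc => hF' _ ?_, fun hl j => (ha j).resolve_right ?_,
    by rw [hw, hcard]⟩
  · rcases ha j with h | h
    · omega
    · rw [hF, Finset.mem_image] at h
      obtain ⟨⟨v, c⟩, -, h⟩ := h
      rw [← h]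
      simp only [labelCode]
      have := v.2
      have : (c : ℕ) * n ≤ 1 * n := Nat.mul_le_mul_right _ (by omega)
      omega
  · rw [hF, Finset.mem_image]
    exact ⟨⟨v, c⟩, by simp [hS, hv, hc], rfl⟩
  · simp [hF, hS, hl]

/-- The run appends the labels of `f` layer by layer. After `2 * n + 2` steps both current layers
have index greater than `n` and are empty, so only the cost is left in the configuration. -/
theorem reachable_of_isRainbowFunction (hl : IsLayering G lam) (hn : ∀ y, lam y ≤ n)
    {f : Fin n → Finset (Fin 2)} (hf : IsRainbowFunction 2 G f)
    (hk : ∀ t, ∑ y with lam y = t, (f y).card ≤ k) (hc : rainbowCost f < 2 * n + 2) :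
    Reachable k G lam (2 * n + 2) (fun j => if j = 2 * k then rainbowCost f else 0) := by
  choose a ha hlab hzero hw using fun t => exists_layer_block f t (hk t)
  set W : ℕ → ℕ := fun t => ∑ y with lam y ≤ t, (f y).card with hW
  have hWle : ∀ t, W t ≤ rainbowCost f := fun t =>
    Finset.sum_le_sum_of_subset (Finset.filter_subset _ _)
  have hWsucc : ∀ t, W (t + 1) = W t + ∑ y with lam y = t + 1, (f y).card := by
    intro t
    simp only [hW]
    rw [← Finset.sum_union]
    · congr 1
      ext y
      simp only [Finset.mem_filter, Finset.mem_univ, true_and, Finset.mem_union]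
      omega
    · rw [Finset.disjoint_filter]
      intro y _ h
      omega
  have key : ∀ t, Reachable k G lam t
      (fun j => if j < k then a (t - 1) j else if j < 2 * k then a t (j - k) else W t) := by
    intro t
    induction t with
    | zero =>
      intro j hj
      -- Layer `0` is empty, so the truncated index `t - 1` is harmless at `t = 0`.
      have h0 := hzero 0 hl.pos
      simp only [h0, Nat.zero_sub]
      have : W 0 = 0 := by
        simp only [hW]
        rw [Finset.filter_false_of_mem, Finset.sum_empty]
        exact fun y _ h => hl.pos y (by omega)
      split_ifs <;> first | rfl | exact this
    | succ t ih =>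
      set u : ℕ → ℕ := fun j => if j < k then a (t - 1) j else if j < 2 * k then a t (j - k) else
        if j = 2 * k then W t else a (t + 1) (j - (2 * k + 1)) with hu
      have hu₀ : ∀ j < k, u j = a (t - 1) j := fun j hj => if_pos hj
      have hu₁ : ∀ j < k, u (k + j) = a t j := fun j hj => by
        simp only [hu]
        rw [if_neg (by omega), if_pos (by omega), Nat.add_sub_cancel_left]
      have hu₂ : u (2 * k) = W t := by
        simp only [hu]
        rw [if_neg (by omega), if_neg (by omega), if_pos trivial]
      have hu₃ : ∀ j < k, u (2 * k + 1 + j) = a (t + 1) j := fun j hj => by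
        simp only [hu]
        rw [if_neg (by omega), if_neg (by omega), if_neg (by omega), Nat.add_sub_cancel_left]
      have hbw : blockWeight k (2 * k + 1) u = ∑ y with lam y = t + 1, (f y).card := by
        rw [blockWeight_eq, ← hw]
        congr 1
        refine Finset.filter_congr fun j hj => ?_
        rw [hu₃ j (Finset.mem_range.mp hj)]
      refine ⟨u, fun j _ => ?_, ih.congr fun j hj => ?_, ?_, ?_, fun j hj => ?_, fun j hj => ?_, ?_⟩
      · simp only [hu]
        split_ifs
        · exact ha _ _
        · exact ha _ _
        · exact (hWle t).trans_lt hc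
        · exact ha _ _
      · simp only [hu]
        split_ifs with h₁ h₂ h₃
        · rfl
        · rfl
        · rfl
        · omega
      · rw [hu₂, hbw, ← hWsucc]
        exact (hWle _).trans_lt hc
      · intro y hy
        by_cases hfy : f y = ∅
        · right
          intro c hc
          obtain ⟨z, hyz, hz⟩ := hf y hfy ⟨c, hc⟩
          have h₁ := hl.edge _ _ hyz
          have h₂ := hl.edge _ _ hyz.symm
          have h₃ := hl.pos y
          obtain ⟨j, hj, hjz⟩ := hlab (lam z) z ⟨c, hc⟩ rfl hz
          refine ⟨z, hyz, ?_⟩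
          rcases (by omega : lam z = t - 1 ∨ lam z = t ∨ lam z = t + 1) with h | h | h
          · exact Or.inl ⟨j, hj, by rw [Nat.zero_add, hu₀ j hj, ← h, hjz]⟩
          · exact Or.inr (Or.inl ⟨j, hj, by rw [hu₁ j hj, ← h, hjz]⟩)
          · exact Or.inr (Or.inr ⟨j, hj, by rw [hu₃ j hj, ← h, hjz]⟩)
        · obtain ⟨c, hc⟩ := Finset.nonempty_iff_ne_empty.mpr hfy
          obtain ⟨j, hj, hjy⟩ := hlab t y c hy hc
          exact Or.inl ⟨c, c.2, j, hj, by rw [hu₁ j hj, hjy]⟩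
      · beta_reduce
        rw [if_pos hj, hu₁ j hj, Nat.add_sub_cancel]
      · beta_reduce
        rw [if_neg (by omega), if_pos (by omega), hu₃ j hj, Nat.add_sub_cancel_left]
      · beta_reduce
        rw [if_neg (by omega), if_neg (by omega), hu₂, hbw, hWsucc]
  refine (key (2 * n + 2)).congr fun j hj => ?_
  have h₁ := hzero (2 * n + 2 - 1) fun v => by have := hn v; omega
  have h₂ := hzero (2 * n + 2) fun v => by have := hn v; omega
  have h₃ : W (2 * n + 2) = rainbowCost f := by
    simp only [hW, rainbowCost]
    rw [Finset.filter_true_of_mem]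
    exact fun y _ => by have := hn y; omega
  simp only [h₁, h₂, h₃]
  split_ifs <;> first | rfl | omega

/-- Both colors everywhere cost `2 * n`. Hence an optimal cost fits into a digit below the common
bound. -/
theorem rainbowDominationNumber_two_lt (G : SimpleGraph (Fin n)) :
    rainbowDominationNumber 2 G < 2 * n + 2 := by
  refine lt_of_le_of_lt ((rainbowDominationNumber_isLeast 2 G).2
    ⟨fun _ => Finset.univ, fun x hx c => ?_, rfl⟩) ?_
  · have : c ∈ (∅ : Finset (Fin 2)) := hx ▸ Finset.mem_univ c
    simp at this
  · simp [rainbowCost]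
    omega

/-- The block length is `24 = 6 * 4`, from `weight_le` with four dominators, and the cost sits at
position `48 = 2 * 24`. The segments enter only through this weight bound, which puts an optimal
function within reach of the dynamic program. -/
theorem rainbowDominationNumber_isLeast_reachable (hG : IsPermutationGraph G)
    (hl : IsLayering G lam) (hn : ∀ y, lam y ≤ n) :
    IsLeast {c | Reachable 24 G lam (2 * n + 2) (fun j => if j = 48 then c else 0)}
      (rainbowDominationNumber 2 G) := by
  obtain ⟨p, q, hpq⟩ := hG.exists_isDiagram
  obtain ⟨⟨f, hf, hfc⟩, hleast⟩ := rainbowDominationNumber_isLeast 2 G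
  constructor
  · have := reachable_of_isRainbowFunction hl hn hf
      (fun t => hl.weight_le (m := 4) (hpq.exists_dominating hl) hf hfc) (by
        rw [hfc]
        exact rainbowDominationNumber_two_lt G)
    rwa [hfc] at this
  · intro c hc
    obtain ⟨f, h₁, -, h₂⟩ := Reachable.exists_labeling hc
    rw [if_pos rfl] at h₁
    refine le_trans (hleast ⟨f, fun y hy => h₂ y ?_ hy, rfl⟩) h₁
    have := hn y
    omega

end DynamicProgram

namespace RAM

/-! ### Tasks -/

/-- A program can, in polynomial time, transform every memory `s` into a memory `s'` with
`Φ s s'`, without changing the common bound of the loops. -/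
def Task (Φ : State → State → Prop) : Prop :=
  ∃ (P : Program) (p : Polynomial ℕ), ∀ s, ∃ s' t, Exec P s s' t ∧ t ≤ p.eval (s 4 0) ∧
    s 4 0 = s' 4 0 ∧ Φ s s'

section Task

variable {Φ Ψ : State → State → Prop}

theorem Task.mono (h : Task Φ) (hΦ : ∀ s s', Φ s s' → Ψ s s') : Task Ψ := by
  obtain ⟨P, p, h⟩ := h
  refine ⟨P, p, fun s => ?_⟩
  obtain ⟨s', t, h₁, h₂, h₃, h₄⟩ := h s
  exact ⟨s', t, h₁, h₂, h₃, hΦ s s' h₄⟩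

theorem Task.seq (h : Task Φ) (h' : Task Ψ) : Task (fun s s'' => ∃ s', Φ s s' ∧ Ψ s' s'') := by
  obtain ⟨P, p, h⟩ := h
  obtain ⟨P', p', h'⟩ := h'
  refine ⟨.seq P P', p + p', fun s => ?_⟩
  obtain ⟨s', t, h₁, h₂, h₃, h₄⟩ := h s
  obtain ⟨s'', t', h₁', h₂', h₃', h₄'⟩ := h' s'
  refine ⟨s'', _, Exec.seq h₁ h₁', ?_, h₃.trans h₃', s', h₄, h₄'⟩
  rw [Polynomial.eval_add, h₃]
  rw [h₃] at h₂
  exact Nat.add_le_add h₂ h₂'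

theorem Task.write (b : ℕ) (hb : b ≠ 4) (i e : Expr) :
    Task (fun s s' => s' = s.set b (i.val s) (e.val s)) :=
  ⟨.write b i e, Polynomial.C (i.cost + e.cost + 1), fun s =>
    ⟨_, _, Exec.write b i e s, by simp, (State.set_bank hb.symm _).symm, rfl⟩⟩

/-- The quantifier over invariants comes after the program, so a single program serves invariants
that mention the graph. In the proof, `exec_for` is applied to the conjunction of all invariants
that hold initially and are preserved. -/
theorem Task.for (h : Task Φ) (hΦ : ∀ s s', Φ s s' → s' 2 0 = s 2 0) :
    Task (fun s s' => ∀ I : ℕ → State → Prop, I 0 (s.set 2 0 0) →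
      (∀ i < s 4 0, ∀ u u', I i u → u 4 0 = s 4 0 → u 2 0 = i → Φ u u' →
        I (i + 1) (u'.set 2 0 (i + 1))) → I (s 4 0) s') := by
  obtain ⟨P, p, h⟩ := h
  refine ⟨P.for 0, (Polynomial.X + Polynomial.C 1) * (p + Polynomial.C 12) + Polynomial.C 3,
    fun s => ?_⟩
  obtain ⟨s', t, he, ht, hN, -, hI⟩ := exec_for (d := 0) (P := P) (N := s 4 0)
    (T := p.eval (s 4 0)) (s := s)
    (I := fun j v => v 4 0 = s 4 0 ∧ v 2 0 = j ∧ ∀ I : ℕ → State → Prop, I 0 (s.set 2 0 0) →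
      (∀ i < s 4 0, ∀ u u', I i u → u 4 0 = s 4 0 → u 2 0 = i → Φ u u' →
        I (i + 1) (u'.set 2 0 (i + 1))) → I j v)
    (fun i v hv => ⟨hv.1, hv.2.1⟩)
    (by
      rintro i v hi ⟨hN, hv, hI⟩
      obtain ⟨v', t, he, ht, hN', hv'⟩ := h v
      rw [hN] at ht
      refine ⟨v', t, he, ht, by rw [hΦ v v' hv', hv], ?_, by simp, fun I h₀ hs => ?_⟩
      · rw [State.set_bank (by decide), ← hN', hN]
      · exact hs i hi v v' (hI I h₀ hs) hN hv hv')
    ⟨State.set_bank (by decide) _, by simp, fun I h₀ _ => h₀⟩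
  exact ⟨s', t, he, by simpa using ht, hN.symm, hI⟩

theorem Scatter.task {d c : ℕ} {W : State → ℕ → ℕ → Prop} (hc : c ≠ 4) (h : Scatter d c W) :
    Task (fun s s' => Agree d c s s' ∧
      ∀ i, W s i (s' c i) ∨ ((∀ v, ¬ W s i v) ∧ s' c i = s c i)) := by
  obtain ⟨-, P, p, h⟩ := h
  refine ⟨P, p, fun s => ?_⟩
  obtain ⟨s', t, h₁, h₂, h₃, h₄⟩ := h s
  exact ⟨s', t, h₁, h₂, h₃.lim hc, h₃, h₄⟩

/-- Tabulation of the multiples of a number. -/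
theorem Task.multiples {b : ℕ} (hb₂ : b ≠ 2) (hb₄ : b ≠ 4) {e : Expr}
    (he : Local 0 b (Expr.val · e)) :
    Task (fun s s' => Agree 0 b s s' ∧ ∀ x ≤ s 4 0, s' b x = x * e.val s) := by
  have hfor := (Task.write b hb₄ (.add (.var 0) (.const 1)) (.add (.read b (.var 0)) e)).for
    (by rintro s _ rfl; exact State.set_bank hb₂.symm _)
  refine ((Task.write b hb₄ (.const 0) (.const 0)).seq hfor).mono ?_
  rintro s s' ⟨_, rfl, h⟩
  have hN : ∀ v, (s.set b 0 v) 4 0 = s 4 0 := fun v => State.set_bank hb₄.symm _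
  have := h (fun i v => Agree 0 b s v ∧ ∀ x ≤ i, v b x = x * e.val s) ?_ ?_
  · simpa [Expr.val, hN] using this
  · refine ⟨((Agree.refl _ _ _).set_right _ _ _ (Or.inr (Or.inl rfl))).set_right _ _ _
      (Or.inr (Or.inr ⟨rfl, le_rfl⟩)), fun x hx => ?_⟩
    obtain rfl : x = 0 := by omega
    rw [State.set_bank hb₂]
    simp [Expr.val]
  · rintro i - u _ ⟨ha, hu⟩ - hi rfl
    refine ⟨(ha.set_right _ _ _ (Or.inr (Or.inl rfl))).set_right _ _ _
      (Or.inr (Or.inr ⟨rfl, le_rfl⟩)), fun x hx => ?_⟩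
    rw [State.set_bank hb₂]
    have hev := he s u ha
    simp only at hev
    simp only [Expr.val, hi]
    rcases Nat.lt_succ_iff_lt_or_eq.mp (Nat.lt_succ_of_le hx) with hx | rfl
    · rw [State.set_index (by omega)]
      exact hu x (by omega)
    · rw [State.set_same, hu i le_rfl, hev]
      ring

/-- Tabulation of the products `x * N ^ j`, where `N` is the common bound of the loops. -/
theorem Task.powers (K : ℕ) :
    Task (fun s s' => (∀ b i, b ≠ 2 → b ≠ 3 → b < 100 → s b i = s' b i) ∧
      ∀ j ≤ K, ∀ x ≤ s 4 0, s' (100 + j) x = x * s 4 0 ^ j) := by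
  induction K with
  | zero =>
    refine (Task.multiples (b := 100) (by decide) (by decide) (local_const 1)).mono ?_
    rintro s s' ⟨ha, h⟩
    refine ⟨fun b i h₂ h₃ hb => ha b i h₃ (by omega) (fun h => absurd h h₂), fun j hj x hx => ?_⟩
    obtain rfl : j = 0 := by omega
    simpa [Expr.val] using h x hx
  | succ K ih =>
    -- The entry at `N` in the table of exponent `K` is `N ^ (K + 1)`, the increment for the next
    -- table. For this reason the tables include the index `N` itself.
    refine (ih.seq (Task.multiples (b := 100 + (K + 1)) (by omega) (by omega)
      (local_read (b := 100 + K) (local_read (b := 4) (local_const 0) (by omega) (by omega)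
        (by omega)) (by omega) (by omega) (by omega)))).mono ?_
    rintro s s' ⟨u, ⟨hu, hp⟩, ha, h⟩
    have hag : ∀ b i, b ≠ 2 → b ≠ 3 → b ≠ 100 + (K + 1) → u b i = s' b i :=
      fun b i h₂ h₃ hb => ha b i h₃ hb (fun h => absurd h h₂)
    refine ⟨fun b i h₂ h₃ hb => (hu b i h₂ h₃ hb).trans (hag b i h₂ h₃ (by omega)),
      fun j hj x hx => ?_⟩
    have h4 : s 4 0 = u 4 0 := hu 4 0 (by decide) (by decide) (by decide)
    by_cases hjK : j ≤ K
    · rw [← hag _ _ (by omega) (by omega) (by omega), hp j hjK x hx]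
    · obtain rfl : j = K + 1 := by omega
      rw [h x (h4 ▸ hx)]
      simp only [Expr.val]
      rw [← h4, hp K le_rfl _ le_rfl]
      ring

end Task

/-! ### Sums and addresses -/

/-- The sum of the expressions `f 0, …, f (k - 1)`. -/
def Expr.sum (f : ℕ → Expr) : ℕ → Expr
  | 0 => .const 0
  | k + 1 => .add (Expr.sum f k) (f k)

theorem Expr.val_sum (f : ℕ → Expr) (k : ℕ) (s : State) :
    (Expr.sum f k).val s = ∑ j ∈ Finset.range k, (f j).val s := by
  induction k with
  | zero => simp [Expr.sum, Expr.val]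
  | succ k ih => rw [Finset.sum_range_succ, ← ih]; rfl

theorem local_sum {d c : ℕ} {f : ℕ → Expr} {k : ℕ} (h : ∀ j < k, Local d c (Expr.val · (f j))) :
    Local d c (Expr.val · (Expr.sum f k)) := by
  induction k with
  | zero => exact local_const 0
  | succ k ih => exact local_add (ih fun j hj => h j (by omega)) (h k (by omega))

/-- The number with the digits `x 0, …, x (m - 1)` in base `N`. -/
def address (N m : ℕ) (x : ℕ → ℕ) : ℕ := ∑ j ∈ Finset.range m, x j * N ^ j

theorem address_succ (N m : ℕ) (x : ℕ → ℕ) :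
    address N (m + 1) x = x 0 + N * address N m (fun j => x (j + 1)) := by
  rw [address, Finset.sum_range_succ', address, Finset.mul_sum, add_comm]
  congr 1
  · simp
  · exact Finset.sum_congr rfl fun j _ => by ring

/-- Digits in base `N` are unique, so different configurations occupy different registers. -/
theorem address_inj {N m : ℕ} {x y : ℕ → ℕ} (hx : ∀ j < m, x j < N) (hy : ∀ j < m, y j < N)
    (h : address N m x = address N m y) : ∀ j < m, x j = y j := by
  induction m generalizing x y with
  | zero => intro j hj; omega
  | succ m ih =>
    rw [address_succ, address_succ] at h
    have hx0 := hx 0 (by omega)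
    have hy0 := hy 0 (by omega)
    have h₁ : x 0 = y 0 := by
      have := congrArg (· % N) h
      simpa [Nat.mod_eq_of_lt hx0, Nat.mod_eq_of_lt hy0] using this
    rw [h₁, Nat.add_left_cancel_iff] at h
    have h₂ := ih (fun j hj => hx (j + 1) (by omega)) (fun j hj => hy (j + 1) (by omega))
      (Nat.eq_of_mul_eq_mul_left (by omega) h)
    intro j hj
    rcases j with _ | j
    · exact h₁
    · exact h₂ j (by omega)

theorem address_congr {N m : ℕ} {x y : ℕ → ℕ} (h : ∀ j < m, x j = y j) :
    address N m x = address N m y :=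
  Finset.sum_congr rfl fun j hj => by rw [h j (Finset.mem_range.mp hj)]

end RAM

namespace RAM

/-! ### The input and its auxiliary tables -/

/-- The memory holds the size of the graph, the bound of the loops, the adjacency matrix with the
table of the positions of its rows, and tables for addresses with `K + 1` digits. -/
structure HasTables {n : ℕ} (G : SimpleGraph (Fin n)) (K : ℕ) (s : State) : Prop where
  size : s 0 0 = n
  lim : s 4 0 = 2 * n + 2
  adj : ∀ y z : Fin n, s 1 (s 9 y + z) ≠ 0 ↔ G.Adj y z
  pow : ∀ j ≤ K, ∀ x ≤ 2 * n + 2, s (100 + j) x = x * (2 * n + 2) ^ j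

section Tables

variable {n K : ℕ} {G : SimpleGraph (Fin n)} {s s' : State}

theorem HasTables.congr (h : HasTables G K s)
    (hs : ∀ b i, b < 2 ∨ b = 4 ∨ 9 ≤ b → s b i = s' b i) : HasTables G K s' where
  size := by rw [← hs _ _ (by omega), h.size]
  lim := by rw [← hs _ _ (by omega), h.lim]
  adj y z := by rw [← hs _ _ (by omega), ← hs _ _ (by omega), h.adj]
  pow j hj x hx := by rw [← hs _ _ (by omega), h.pow j hj x hx]

theorem HasTables.agree (h : HasTables G K s) {d c : ℕ} (hs : Agree d c s s') (hc : 5 ≤ c)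
    (hc' : c ≤ 8) : HasTables G K s' :=
  h.congr fun b i hb => hs b i (by omega) (by omega) (by omega)

theorem HasTables.set_var (h : HasTables G K s) (i v : ℕ) : HasTables G K (s.set 2 i v) :=
  h.congr fun _ _ hb => (State.set_bank (by omega) _).symm

end Tables

/-! ### Computation of the greedy layering -/

/-- The test whether the vertex in variable `1` enters layer `t + 1`, where `t` is the content of
variable `0`; bank `6` holds the layers so far. -/
def EntersTest (s : State) : Prop :=
  s 2 1 < s 0 0 ∧ s 6 (s 2 1) = 0 ∧
    ((∃ z < s 4 0, (z < s 0 0 ∧ s 6 z ≠ 0 ∧ s 6 z = s 2 0) ∧ s 1 (s 9 (s 2 1) + z) ≠ 0) ∨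
      ((∀ u < s 4 0, u < s 0 0 → s 6 u = 0 → ∀ z < s 4 0,
        (z < s 0 0 ∧ s 6 z ≠ 0 ∧ s 6 z = s 2 0) → s 1 (s 9 u + z) = 0) ∧
        ∀ u < s 4 0, u < s 2 1 → s 6 u ≠ 0))

theorem dec_entersTest : Dec 2 5 EntersTest := by
  have hn : ∀ d, Local d 5 (Expr.val · (.read 0 (.const 0))) := fun d =>
    local_read (local_const 0) (by decide) (by decide) (by decide)
  have hv : ∀ d j, j < d → Local d 5 (Expr.val · (.var j)) := fun d j hj =>
    local_var (by decide) hj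
  have hl : ∀ d j, j < d → Local d 5 (Expr.val · (.read 6 (.var j))) := fun d j hj =>
    local_read (hv d j hj) (by decide) (by decide) (by decide)
  have ha : ∀ d i j, i < d → j < d →
      Local d 5 (Expr.val · (.read 1 (.add (.read 9 (.var i)) (.var j)))) := fun d i j hi hj =>
    local_read (local_add (local_read (hv d i hi) (by decide) (by decide) (by decide)) (hv d j hj))
      (by decide) (by decide) (by decide)
  have hprev : ∀ d j, 0 < d → j < d → Dec d 5 (fun s => (Expr.var j).val s <
      (Expr.read 0 (.const 0)).val s ∧ (Expr.read 6 (.var j)).val s ≠ 0 ∧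
      (Expr.read 6 (.var j)).val s = (Expr.var 0).val s) := fun d j h0 hj =>
    (Dec.lt (hv d j hj) (hn d)).and ((Dec.atom (hl d j hj)).and (Dec.eq (hl d j hj) (hv d 0 h0)))
  refine ((Dec.lt (hv 2 1 (by decide)) (hn 2)).and ((Dec.eq (hl 2 1 (by decide))
    (local_const 0)).and (((((hprev 3 2 (by decide) (by decide)).and
      (Dec.atom (ha 3 1 2 (by decide) (by decide)))).ex (by decide)).or
    (((((Dec.lt (hv 3 2 (by decide)) (hn 3)).imp ((Dec.eq (hl 3 2 (by decide))
      (local_const 0)).imp (((hprev 4 3 (by decide) (by decide)).imp (Dec.eq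
        (ha 4 2 3 (by decide) (by decide)) (local_const 0))).all (by decide)))).all (by decide)).and
    (((Dec.lt (hv 3 2 (by decide)) (hv 3 1 (by decide))).imp
      (Dec.atom (hl 3 2 (by decide)))).all (by decide)))))))).congr fun s => ?_
  simp [Expr.val, State.set, EntersTest]

theorem entersTest_iff {n K : ℕ} {G : SimpleGraph (Fin n)} {s : State} (hs : HasTables G K s)
    {lam : Fin n → ℕ} (hlam : ∀ y : Fin n, s 6 y = lam y) {y : Fin n} (hy : s 2 1 = y) :
    EntersTest s ↔ EntersLayer G (s 2 0) lam y := by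
  have hlt : ∀ z : Fin n, (z : ℕ) < 2 * n + 2 := fun z => by omega
  simp only [EntersTest, EntersLayer, hs.size, hs.lim, hy, hlam]
  constructor
  · rintro ⟨-, h₀, ⟨z, -, ⟨hzn, hz₀, hzt⟩, hz⟩ | ⟨h₁, h₂⟩⟩
    · rw [hlam ⟨z, hzn⟩] at hz₀ hzt
      exact ⟨h₀, Or.inl ⟨⟨z, hzn⟩, hz₀, hzt, (hs.adj y ⟨z, hzn⟩).mp hz⟩⟩
    · refine ⟨h₀, Or.inr ⟨fun u hu z hz₀ hzt huz => ?_, fun u hu => ?_⟩⟩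
      · exact (hs.adj u z).mpr huz (h₁ u (hlt u) u.2 (by rw [hlam, hu]) z (hlt z)
          ⟨z.2, by rwa [hlam], by rwa [hlam]⟩)
      · rw [← hlam]
        exact h₂ u (hlt u) hu
  · rintro ⟨h₀, ⟨z, hz₀, hzt, hz⟩ | ⟨h₁, h₂⟩⟩
    · exact ⟨y.2, h₀, Or.inl ⟨z, hlt z, ⟨z.2, by rwa [hlam], by rwa [hlam]⟩,
        (hs.adj y z).mpr hz⟩⟩
    · refine ⟨y.2, h₀, Or.inr ⟨fun u _ hun hu z _ ⟨hzn, hz₀, hzt⟩ => ?_, fun u _ hu => ?_⟩⟩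
      · by_contra h
        rw [hlam ⟨z, hzn⟩] at hz₀ hzt
        rw [hlam ⟨u, hun⟩] at hu
        exact h₁ ⟨u, hun⟩ hu ⟨z, hzn⟩ hz₀ hzt ((hs.adj ⟨u, hun⟩ ⟨z, hzn⟩).mp h)
      · have := h₂ ⟨u, hu.trans y.2⟩ hu
        rwa [← hlam] at this

/-- A round writes the new stage to bank 5 while bank 6 keeps the previous one, so all vertices are
tested against the same stage; then bank 5 is copied to bank 6. -/
theorem task_greedyLayering :
    Task (fun s s' => ∀ (n K : ℕ) (G : SimpleGraph (Fin n)), HasTables G K s →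
      (∀ b i, 5 ≤ b → b ≤ 8 → s b i = 0) →
      HasTables G K s' ∧ (∀ y : Fin n, s' 6 y = greedyLayering G (2 * n + 2) y) ∧
        ∀ b i, 7 ≤ b → b ≤ 8 → s' b i = 0) := by
  have h₁ := ((Scatter.write (c := 5) (by decide) (by decide) dec_entersTest
    (local_var (j := 1) (by decide) (by decide)) (local_add (local_var (j := 0) (by decide)
      (by decide)) (local_const 1))).loop (by decide) (by decide)).task (by decide)
  have h₂ := ((Scatter.write (d := 2) (c := 6) (by decide) (by decide) Dec.true
    (local_var (j := 1) (by decide) (by decide)) (local_read (b := 5) (local_var (j := 1)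
      (by decide) (by decide)) (by decide) (by decide) (by decide))).loop (by decide)
        (by decide)).task (by decide)
  refine ((h₁.seq h₂).for ?_).mono ?_
  · rintro s s' ⟨u, ⟨ha, -⟩, ha', -⟩
    exact ((ha.var (by decide) (by decide)).trans (ha'.var (by decide) (by decide))).symm
  · intro s s' h n K G hs h0
    rw [hs.lim] at h
    have := h (fun t u => HasTables G K u ∧ (∀ y : Fin n, u 5 y = greedyLayering G t y) ∧
      (∀ y : Fin n, u 6 y = greedyLayering G t y) ∧ ∀ b i, 7 ≤ b → b ≤ 8 → u b i = 0) ?_ ?_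
    · exact ⟨this.1, this.2.2.1, this.2.2.2⟩
    · refine ⟨hs.set_var _ _, fun y => ?_, fun y => ?_, fun b i hb hb' => ?_⟩ <;>
        rw [State.set_bank (by omega), h0 _ _ (by omega) (by omega)]
      · rfl
      · rfl
    · rintro t - u w ⟨hu, hu₅, hu₆, hu₀⟩ - ht ⟨v, ⟨ha, hW⟩, ha', hW'⟩
      have hv : HasTables G K v := hu.agree ha (by omega) (by omega)
      have hw : HasTables G K w := hv.agree ha' (by omega) (by omega)
      have hlt : ∀ y : Fin n, (y : ℕ) < 2 * n + 2 := fun y => by omega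
      have hv₅ : ∀ y : Fin n, v 5 y = greedyLayering G (t + 1) y := by
        intro y
        have hset : EntersTest (u.set 2 1 y) ↔ EntersLayer G t (greedyLayering G t) y := by
          rw [entersTest_iff (hu.set_var 1 y) (fun z => ?_) (State.set_same _ _ _ _),
            State.set_index (by decide), ht]
          rw [State.set_bank (by decide), hu₆]
        simp only [greedyLayering]
        rcases hW y with ⟨a, -, hQ, hay, hv⟩ | ⟨hn, hv⟩
        · simp only [Expr.val, State.set_same] at hay hv
          rw [State.set_index (by decide), ht] at hv
          rw [← hay, hset] at hQ
          rw [if_pos hQ, hv]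
        · rw [if_neg, hv, hu₅]
          intro hE
          refine hn (t + 1) ⟨y, by rw [hu.lim]; exact hlt y, hset.mpr hE, by simp [Expr.val], ?_⟩
          simp only [Expr.val]
          rw [State.set_index (by decide), ht]
      have hw₅ : ∀ i, w 5 i = v 5 i := fun i =>
        (ha' 5 i (by decide) (by decide) (by omega)).symm
      refine ⟨hw.set_var _ _, fun y => ?_, fun y => ?_, fun b i hb hb' => ?_⟩
      · rw [State.set_bank (by decide), hw₅, hv₅]
      · rw [State.set_bank (by decide)]
        rcases hW' y with ⟨a, -, -, hay, hv⟩ | ⟨hn, -⟩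
        · simp only [Expr.val, State.set_same] at hay hv
          rw [hv, State.set_bank (by decide), ← hay, hv₅]
        · exact absurd ⟨y, by rw [hv.lim]; exact hlt y, trivial, by simp [Expr.val], rfl⟩ (hn _)
      · rw [State.set_bank (by omega), ← ha' b i (by omega) (by omega) (by omega),
          ← ha b i (by omega) (by omega) (by omega), hu₀ b i hb hb']

end RAM

/-! ### Congruence for the dynamic program -/

section Congruence

variable {n k : ℕ}

theorem BlockHas.congr {a v c : ℕ} {u u' : ℕ → ℕ} (h : ∀ j < k, u (a + j) = u' (a + j)) :
    BlockHas n k a u v c ↔ BlockHas n k a u' v c :=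
  exists_congr fun j => and_congr_right fun hj => by rw [h j hj]

theorem blockWeight_congr {a : ℕ} {u u' : ℕ → ℕ} (h : ∀ j < k, u (a + j) = u' (a + j)) :
    blockWeight k a u = blockWeight k a u' :=
  Finset.sum_congr rfl fun j hj => by rw [h j (Finset.mem_range.mp hj)]

theorem LayerDominated.congr {G : SimpleGraph (Fin n)} {lam : Fin n → ℕ} {t : ℕ} {u u' : ℕ → ℕ}
    (h : LayerDominated k G lam t u) (hu : ∀ j < 3 * k + 1, u j = u' j) :
    LayerDominated k G lam t u' := by
  have key : ∀ a v c, a ≤ 2 * k + 1 → (BlockHas n k a u v c ↔ BlockHas n k a u' v c) :=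
    fun a v c ha => BlockHas.congr fun j hj => hu _ (by omega)
  intro y hy
  have := h y hy
  simpa only [key k _ _ (by omega), key 0 _ _ (by omega), key (2 * k + 1) _ _ le_rfl] using this

/-- The successor of the configuration in the first three parts of `u`, if the labels in the fourth
part are appended. -/
def nextConfiguration (k : ℕ) (u : ℕ → ℕ) (j : ℕ) : ℕ :=
  if j < k then u (k + j) else if j < 2 * k then u (2 * k + 1 + (j - k)) else
    u (2 * k) + blockWeight k (2 * k + 1) u

theorem nextConfiguration_lt {u : ℕ → ℕ} {N : ℕ} (hu : ∀ j < 3 * k + 1, u j < N)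
    (hc : u (2 * k) + blockWeight k (2 * k + 1) u < N) {j : ℕ} (hj : j < 2 * k + 1) :
    nextConfiguration k u j < N := by
  rw [nextConfiguration]
  split_ifs
  · exact hu _ (by omega)
  · exact hu _ (by omega)
  · exact hc

theorem reachable_succ_iff {G : SimpleGraph (Fin n)} {lam : Fin n → ℕ} {t : ℕ} {x : ℕ → ℕ} :
    Reachable k G lam (t + 1) x ↔ ∃ u : ℕ → ℕ, (∀ j < 3 * k + 1, u j < 2 * n + 2) ∧
      Reachable k G lam t u ∧ u (2 * k) + blockWeight k (2 * k + 1) u < 2 * n + 2 ∧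
      LayerDominated k G lam t u ∧ ∀ j < 2 * k + 1, x j = nextConfiguration k u j := by
  simp only [Reachable]
  refine exists_congr fun u => and_congr_right fun _ => and_congr_right fun _ =>
    and_congr_right fun _ => and_congr_right fun _ => ⟨fun ⟨h₁, h₂, h₃⟩ j hj => ?_, fun h =>
      ⟨fun j hj => ?_, fun j hj => ?_, ?_⟩⟩
  · rw [nextConfiguration]
    split_ifs with hk hk'
    · exact h₁ j hk
    · rw [← h₂ _ (by omega), Nat.add_sub_cancel' (by omega)]
    · rw [← h₃]
      congr 1
      omega
  · rw [h j (by omega), nextConfiguration, if_pos hj]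
  · rw [h _ (by omega), nextConfiguration, if_neg (by omega), if_pos (by omega),
      Nat.add_sub_cancel_left]
  · rw [h _ (by omega), nextConfiguration, if_neg (by omega), if_neg (by omega)]

end Congruence

namespace RAM

/-! ### Computation of the reachable configurations -/

/-- The contents of the variables `1, 2, …`. -/
def State.tuple (s : State) (j : ℕ) : ℕ := s 2 (1 + j)

/-- The test of `LayerDominated` for the tuple in the variables `1, …, 3 * k + 1` and the layer in
variable `0`. -/
def DominatedTest (k : ℕ) (s : State) : Prop :=
  ∀ y < s 4 0, y < s 0 0 → s 6 y = s 2 0 → (∃ c < 2, BlockHas (s 0 0) k k s.tuple y c) ∨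
    ∀ c < 2, ∃ z < s 4 0, (z < s 0 0 ∧ s 1 (s 9 y + z) ≠ 0) ∧
      (BlockHas (s 0 0) k 0 s.tuple z c ∨ BlockHas (s 0 0) k k s.tuple z c ∨
        BlockHas (s 0 0) k (2 * k + 1) s.tuple z c)

theorem local_size (d : ℕ) : Local d 7 (Expr.val · (.read 0 (.const 0))) :=
  local_read (local_const 0) (by decide) (by decide) (by decide)

theorem dec_blockHas {d k a i c : ℕ} (ha : 1 + a + k ≤ d) (hi : i < d) :
    Dec d 7 (fun s => BlockHas (s 0 0) k a s.tuple (s 2 i) c) := by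
  refine (Dec.existsLt k fun j hj => Dec.eq (local_var (j := 1 + (a + j)) (by decide) (by omega))
    (local_add (local_add (local_var (j := i) (by decide) hi) (local_const 1))
      -- The summand `c * n` of the label code becomes a sum of `c` copies of `n`; the color is a
      -- constant of the program.
      (local_sum (f := fun _ => .read 0 (.const 0)) (k := c) fun _ _ => local_size d))).congr
        fun s => ?_
  simp [Expr.val, Expr.val_sum, BlockHas, State.tuple, labelCode]

theorem BlockHas.set_var {n k a v c d w : ℕ} {s : State} (hd : 1 + a + k ≤ d) :
    BlockHas n k a (s.set 2 d w).tuple v c ↔ BlockHas n k a s.tuple v c :=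
  BlockHas.congr fun j hj => State.set_index (by omega)

theorem dec_dominatedTest (k : ℕ) : Dec (3 * k + 2) 7 (DominatedTest k) := by
  have hv : ∀ d j, j < d → Local d 7 (Expr.val · (.var j)) := fun d j hj =>
    local_var (by decide) hj
  have hlam : Dec (3 * k + 2 + 1) 7 (fun s => (Expr.read 6 (.var (3 * k + 2))).val s =
      (Expr.var 0).val s) :=
    Dec.eq (local_read (hv _ _ (by omega)) (by decide) (by decide) (by decide)) (hv _ _ (by omega))
  have hadj : Dec (3 * k + 2 + 1 + 1) 7 (fun s => (Expr.read 1 (.add (.read 9 (.var (3 * k + 2)))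
      (.var (3 * k + 2 + 1)))).val s ≠ 0) :=
    Dec.atom (local_read (local_add (local_read (hv _ _ (by omega)) (by decide) (by decide)
      (by decide)) (hv _ _ (by omega))) (by decide) (by decide) (by decide))
  refine (((Dec.lt (hv _ (3 * k + 2) (by omega)) (local_size _)).imp (hlam.imp
    ((Dec.existsLt 2 fun c _ => dec_blockHas (k := k) (a := k) (i := 3 * k + 2) (c := c)
      (by omega) (by omega)).or
    (Dec.forallLt 2 fun c _ => (((Dec.lt (hv _ (3 * k + 2 + 1) (by omega)) (local_size _)).and
      hadj).and ((dec_blockHas (k := k) (a := 0) (i := 3 * k + 2 + 1) (c := c) (by omega)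
        (by omega)).or
      ((dec_blockHas (k := k) (a := k) (i := 3 * k + 2 + 1) (c := c) (by omega) (by omega)).or
      (dec_blockHas (k := k) (a := 2 * k + 1) (i := 3 * k + 2 + 1) (c := c) (by omega)
        (by omega))))).ex (by decide))))).all (by decide)).congr fun s => ?_
  have hb : ∀ n a v c w, a ≤ 2 * k + 1 → (BlockHas n k a (s.set 2 (3 * k + 2) w).tuple v c ↔
      BlockHas n k a s.tuple v c) := fun n a v c w ha => BlockHas.set_var (by omega)
  have hb' : ∀ n a v c w w', a ≤ 2 * k + 1 →
      (BlockHas n k a ((s.set 2 (3 * k + 2) w).set 2 (3 * k + 2 + 1) w').tuple v c ↔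
      BlockHas n k a s.tuple v c) := fun n a v c w w' ha =>
    (BlockHas.set_var (by omega)).trans (BlockHas.set_var (by omega))
  simp only [hb _ k _ _ _ (by omega), hb' _ k _ _ _ _ (by omega), hb' _ 0 _ _ _ _ (by omega),
    hb' _ (2 * k + 1) _ _ _ _ le_rfl]
  simp [Expr.val, State.set, DominatedTest]

theorem dominatedTest_iff {n k K : ℕ} {G : SimpleGraph (Fin n)} {s : State}
    (hs : HasTables G K s) {lam : Fin n → ℕ} (hlam : ∀ y : Fin n, s 6 y = lam y) :
    DominatedTest k s ↔ LayerDominated k G lam (s 2 0) s.tuple := by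
  have hlt : ∀ z : Fin n, (z : ℕ) < 2 * n + 2 := fun z => by omega
  simp only [DominatedTest, LayerDominated, hs.size, hs.lim]
  constructor
  · intro h y hy
    refine (h y (hlt y) y.2 (by rw [hlam, hy])).imp_right fun h c hc => ?_
    obtain ⟨z, -, ⟨hz, hyz⟩, hb⟩ := h c hc
    exact ⟨⟨z, hz⟩, (hs.adj y ⟨z, hz⟩).mp hyz, hb⟩
  · intro h y _ hyn hy
    rw [hlam ⟨y, hyn⟩] at hy
    refine (h ⟨y, hyn⟩ hy).imp_right fun h c hc => ?_
    obtain ⟨z, hyz, hb⟩ := h c hc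
    exact ⟨z, hlt z, ⟨z.2, (hs.adj ⟨y, hyn⟩ z).mpr hyz⟩, hb⟩

/-! ### Table addresses and the sweep over configurations -/

/-- The address of the configuration in the variables `1, …, 2 * k + 1`. -/
def sourceAddress (k : ℕ) : Expr :=
  .sum (fun j => .read (100 + j) (.var (1 + j))) (2 * k + 1)

/-- The total cost after the labels in the fourth part of the tuple have been appended. -/
def nextCost (k : ℕ) : Expr :=
  .add (.var (1 + 2 * k))
    (.sum (fun j => .sub (.const 1) (.sub (.const 1) (.var (1 + (2 * k + 1 + j))))) k)

/-- The address of the successor of the configuration in the variables. -/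
def targetAddress (k : ℕ) : Expr :=
  .sum (fun j => .read (100 + j) (if j < k then .var (1 + (k + j)) else
    if j < 2 * k then .var (1 + (2 * k + 1 + (j - k))) else nextCost k)) (2 * k + 1)

theorem val_nextCost (k : ℕ) (s : State) :
    (nextCost k).val s = s.tuple (2 * k) + blockWeight k (2 * k + 1) s.tuple := by
  simp [nextCost, Expr.val, Expr.val_sum, State.tuple, blockWeight]

theorem val_sourceAddress {n k : ℕ} {G : SimpleGraph (Fin n)} {s : State}
    (hs : HasTables G (2 * k) s) (h : ∀ j < 2 * k + 1, s.tuple j < 2 * n + 2) :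
    (sourceAddress k).val s = address (2 * n + 2) (2 * k + 1) s.tuple := by
  rw [sourceAddress, Expr.val_sum, address]
  refine Finset.sum_congr rfl fun j hj => ?_
  rw [Finset.mem_range] at hj
  exact hs.pow j (by omega) _ (h j hj).le

theorem val_targetAddress {n k : ℕ} {G : SimpleGraph (Fin n)} {s : State}
    (hs : HasTables G (2 * k) s)
    (h : ∀ j < 2 * k + 1, nextConfiguration k s.tuple j < 2 * n + 2) :
    (targetAddress k).val s =
      address (2 * n + 2) (2 * k + 1) (nextConfiguration k s.tuple) := by
  rw [targetAddress, Expr.val_sum, address]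
  refine Finset.sum_congr rfl fun j hj => ?_
  rw [Finset.mem_range] at hj
  rw [← hs.pow j (by omega) _ (h j hj).le, Expr.val, nextConfiguration]
  split_ifs
  · rfl
  · rfl
  · rw [val_nextCost]

theorem local_sourceAddress {k d c : ℕ} (hd : 2 * k + 2 ≤ d) (hc : c = 7 ∨ c = 8) :
    Local d c (Expr.val · (sourceAddress k)) :=
  local_sum fun j hj => local_read (local_var (by omega) (by omega)) (by omega) (by omega)
    (by omega)

theorem local_nextCost (k : ℕ) : Local (3 * k + 2) 7 (Expr.val · (nextCost k)) :=
  local_add (local_var (by decide) (by omega)) (local_sum fun j hj =>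
    local_sub (local_const 1) (local_sub (local_const 1) (local_var (by decide) (by omega))))

theorem local_targetAddress (k : ℕ) : Local (3 * k + 2) 7 (Expr.val · (targetAddress k)) := by
  refine local_sum fun j hj => local_read ?_ (by omega) (by omega) (by omega)
  split_ifs
  · exact local_var (by decide) (by omega)
  · exact local_var (by decide) (by omega)
  · exact local_nextCost k

/-- The test whether the tuple in the variables describes a step from a reachable configuration. -/
def StepTest (k : ℕ) (s : State) : Prop :=
  s 8 ((sourceAddress k).val s) = s 2 0 + 1 ∧ (nextCost k).val s < s 4 0 ∧ DominatedTest k s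

theorem dec_stepTest (k : ℕ) : Dec (3 * k + 2) 7 (StepTest k) :=
  (Dec.eq (local_read (b := 8) (local_sourceAddress (by omega) (Or.inl rfl)) (by decide)
    (by decide) (by decide)) (local_add (local_var (j := 0) (by decide) (by omega))
      (local_const 1))).and ((Dec.lt (local_nextCost k) (local_read (b := 4) (local_const 0)
        (by decide) (by decide) (by decide))).and (dec_dominatedTest k))

/-- A configuration is marked by a time stamp: before round `t`, its register in bank 8 holds `t +
1` exactly if it is reachable in `t` steps. Round `t` writes the stamp `t + 2` into bank 7 at the
successors and copies the addressed registers to bank 8. Old stamps are smaller, so nothing has to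
be erased. -/
theorem task_reachable (k : ℕ) :
    Task (fun s s' => ∀ (n : ℕ) (G : SimpleGraph (Fin n)) (lam : Fin n → ℕ),
      HasTables G (2 * k) s → (∀ y : Fin n, s 6 y = lam y) → (∀ i, s 7 i = 0) →
      (∀ i, s 8 i = if i = 0 then 1 else 0) →
      HasTables G (2 * k) s' ∧ ∀ x : ℕ → ℕ, (∀ j < 2 * k + 1, x j < 2 * n + 2) →
        (s' 8 (address (2 * n + 2) (2 * k + 1) x) = 2 * n + 2 + 1 ↔
          Reachable k G lam (2 * n + 2) x)) := by
  have h₁ := (Scatter.loops (d := 1) (m := 3 * k + 1) (by decide) (by decide)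
    ((by omega : 1 + (3 * k + 1) = 3 * k + 2) ▸ Scatter.write (c := 7) (by decide) (by decide)
      (dec_stepTest k) (local_targetAddress k) (local_add (local_var (j := 0) (by decide)
        (by omega)) (local_const 2)))).task (by decide)
  have h₂ := (Scatter.loops (d := 1) (m := 2 * k + 1) (c := 8) (by decide) (by decide)
    (Scatter.write (by decide) (by decide) Dec.true (local_sourceAddress (k := k) (by omega)
      (Or.inr rfl)) (local_read (b := 7) (local_sourceAddress (k := k) (by omega) (Or.inr rfl))
        (by decide) (by decide) (by decide)))).task (by decide)
  refine ((h₁.seq h₂).for ?_).mono ?_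
  · rintro s s' ⟨u, ⟨ha, -⟩, ha', -⟩
    exact ((ha.var (by decide) (by decide)).trans (ha'.var (by decide) (by decide))).symm
  · intro s s' h n G lam hs h₆ h₇ h₈
    rw [hs.lim] at h
    have := h (fun t u => HasTables G (2 * k) u ∧ (∀ y : Fin n, u 6 y = lam y) ∧
      (∀ i, u 7 i ≤ t + 1) ∧ ∀ x : ℕ → ℕ, (∀ j < 2 * k + 1, x j < 2 * n + 2) →
        (u 8 (address (2 * n + 2) (2 * k + 1) x) = t + 1 ↔ Reachable k G lam t x)) ?_ ?_
    · exact ⟨this.1, this.2.2.2⟩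
    · refine ⟨hs.set_var _ _, fun y => ?_, fun i => ?_, fun x hx => ?_⟩
      · rw [State.set_bank (by decide), h₆]
      · rw [State.set_bank (by decide), h₇]
        omega
      · rw [State.set_bank (by decide), h₈]
        -- At time `0` only the zero configuration, at address `0`, carries the stamp `1`.
        have h0 : address (2 * n + 2) (2 * k + 1) (fun _ => 0) = 0 := by simp [address]
        split_ifs with hx0
        · simp only [Reachable, true_iff]
          rw [← h0] at hx0
          exact address_inj hx (fun _ _ => by omega) hx0
        · simp only [Reachable]
          refine ⟨fun h => absurd h (by decide), fun h => absurd ?_ hx0⟩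
          rw [address_congr h, h0]
    · rintro t - u w ⟨hu, hu₆, hu₇, hu₈⟩ - ht ⟨v, ⟨ha, hW⟩, ha', hW'⟩
      have hv : HasTables G (2 * k) v := hu.agree ha (by omega) (by omega)
      have hw : HasTables G (2 * k) w := hv.agree ha' (by omega) (by omega)
      have hwu : ∀ b i, b = 6 → u b i = w b i := fun b i hb =>
        (ha b i (by omega) (by omega) (by omega)).trans (ha' b i (by omega) (by omega) (by omega))
      have hwv : ∀ i, w 7 i = v 7 i := fun i =>
        (ha' 7 i (by decide) (by decide) (by omega)).symm
      have htup : ∀ (s : State) m (x : ℕ → ℕ), ∀ j < m, (s.setVars 1 m x).tuple j = x j :=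
        fun s m x j hj => State.setVars_var hj
      have htab : ∀ m x, HasTables G (2 * k) (u.setVars 1 m x) := fun m x =>
        hu.congr fun b i hb => (State.setVars_bank (by omega) i).symm
      have htab' : ∀ m x, HasTables G (2 * k) (v.setVars 1 m x) := fun m x =>
        hv.congr fun b i hb => (State.setVars_bank (by omega) i).symm
      have hstep : ∀ x : ℕ → ℕ, (∀ j < 3 * k + 1, x j < 2 * n + 2) →
          (StepTest k (u.setVars 1 (3 * k + 1) x) ↔ Reachable k G lam t x ∧
            x (2 * k) + blockWeight k (2 * k + 1) x < 2 * n + 2 ∧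
            LayerDominated k G lam t x) := by
        intro x hx
        have hsrc : (sourceAddress k).val (u.setVars 1 (3 * k + 1) x) =
            address (2 * n + 2) (2 * k + 1) x := by
          rw [val_sourceAddress (htab _ x) fun j hj => by
            rw [htup _ _ x j (by omega)]; exact hx j (by omega)]
          exact address_congr fun j hj => htup _ _ x j (by omega)
        have hdom : LayerDominated k G lam t (u.setVars 1 (3 * k + 1) x).tuple ↔
            LayerDominated k G lam t x :=
          ⟨fun h => h.congr fun j hj => htup _ _ x j hj,
            fun h => h.congr fun j hj => (htup _ _ x j hj).symm⟩
        rw [StepTest, hsrc, val_nextCost, dominatedTest_iff (htab _ x) (lam := lam) fun y => by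
            rw [State.setVars_bank (by decide), hu₆],
          State.setVars_bank (by decide), State.setVars_lt (by decide), ht,
          hu₈ x fun j hj => hx j (by omega), hdom, htup _ _ x _ (by omega),
          blockWeight_congr (u' := x) fun j hj => htup _ _ x _ (by omega), (htab _ x).lim]
      have hnext : ∀ x : ℕ → ℕ, (∀ j < 3 * k + 1, x j < 2 * n + 2) →
          x (2 * k) + blockWeight k (2 * k + 1) x < 2 * n + 2 →
          (targetAddress k).val (u.setVars 1 (3 * k + 1) x) =
            address (2 * n + 2) (2 * k + 1) (nextConfiguration k x) := by
        intro x hx hc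
        have hcg : ∀ j < 2 * k + 1, nextConfiguration k (u.setVars 1 (3 * k + 1) x).tuple j =
            nextConfiguration k x j := by
          intro j hj
          simp only [nextConfiguration]
          rw [blockWeight_congr (u' := x) fun j hj => htup _ _ x _ (by omega),
            htup _ _ x (2 * k) (by omega)]
          split_ifs
          · exact htup _ _ x _ (by omega)
          · exact htup _ _ x _ (by omega)
          · rfl
        rw [val_targetAddress (htab _ x) fun j hj => by
          rw [hcg j hj]; exact nextConfiguration_lt hx hc hj]
        exact address_congr hcg
      have hv₇ : ∀ x : ℕ → ℕ, (∀ j < 2 * k + 1, x j < 2 * n + 2) →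
          (v 7 (address (2 * n + 2) (2 * k + 1) x) = t + 2 ↔ Reachable k G lam (t + 1) x) := by
        intro x hx
        rw [reachable_succ_iff]
        rcases hW (address (2 * n + 2) (2 * k + 1) x) with ⟨z, hz, hQ, hadr, hval⟩ | ⟨hno, hval⟩
        · rw [hu.lim] at hz
          rw [hstep z hz] at hQ
          rw [hnext z hz hQ.2.1] at hadr
          have hval' : v 7 (address (2 * n + 2) (2 * k + 1) x) = t + 2 := by
            rw [hval]
            simp only [Expr.val]
            rw [State.setVars_lt (by decide), ht]
          simp only [hval', true_iff]
          exact ⟨z, hz, hQ.1, hQ.2.1, hQ.2.2,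
            address_inj hx (fun j hj => nextConfiguration_lt hz hQ.2.1 hj) hadr⟩
        -- A register that was not written holds at most `t + 1` and cannot be mistaken for a new
        -- stamp.
        · have := hu₇ (address (2 * n + 2) (2 * k + 1) x)
          refine ⟨fun h => by omega, ?_⟩
          rintro ⟨z, hz, h₁, h₂, h₃, hxz⟩
          refine absurd ⟨z, by rwa [hu.lim], (hstep z hz).mpr ⟨h₁, h₂, h₃⟩, ?_, ?_⟩ (hno (t + 2))
          · rw [hnext z hz h₂]
            exact address_congr hxz
          · simp only [Expr.val]
            rw [State.setVars_lt (by decide), ht]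
      refine ⟨hw.set_var _ _, fun y => ?_, fun i => ?_, fun x hx => ?_⟩
      · rw [State.set_bank (by decide), ← hwu _ _ rfl, hu₆]
      · rw [State.set_bank (by decide), hwv]
        rcases hW i with ⟨z, -, -, -, hval⟩ | ⟨-, hval⟩
        · rw [hval]
          simp only [Expr.val]
          rw [State.setVars_lt (by decide), ht]
        · rw [hval]
          exact (hu₇ i).trans (by omega)
      · rw [State.set_bank (by decide)]
        rw [← hv₇ x hx]
        have hadr : ∀ z : ℕ → ℕ, (∀ j < 2 * k + 1, z j < 2 * n + 2) →
            (sourceAddress k).val (v.setVars 1 (2 * k + 1) z) =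
              address (2 * n + 2) (2 * k + 1) z := by
          intro z hz
          rw [val_sourceAddress (htab' _ z) fun j hj => by
            rw [htup _ _ z j (by omega)]; exact hz j (by omega)]
          exact address_congr fun j hj => htup _ _ z j (by omega)
        rcases hW' (address (2 * n + 2) (2 * k + 1) x) with ⟨z, hz, -, hadrz, hval⟩ | ⟨hno, -⟩
        · rw [hv.lim] at hz
          rw [hval]
          simp only [Expr.val]
          rw [← hadrz, State.setVars_bank (by decide)]
        · refine absurd ⟨x, by rwa [hv.lim], trivial, (hadr x hx).symm, rfl⟩ (hno _)

end RAM

namespace RAM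

/-! ### The main program -/

theorem hasTables_of_graphInput {n K : ℕ} {G : SimpleGraph (Fin n)} {s : State}
    (h₀ : s 0 0 = n) (h₁ : ∀ i, s 1 i = graphInput G 1 i) (h₄ : s 4 0 = 2 * n + 2)
    (h₉ : ∀ x ≤ 2 * n + 2, s 9 x = x * n)
    (hp : ∀ j ≤ K, ∀ x ≤ 2 * n + 2, s (100 + j) x = x * (2 * n + 2) ^ j) : HasTables G K s where
  size := h₀
  lim := h₄
  pow := hp
  adj y z := by
    rw [h₉ y (by omega), h₁]
    simp only [graphInput]
    constructor
    · intro h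
      by_contra hyz
      rw [if_neg (by simp)] at h
      refine h (if_neg ?_)
      rintro ⟨-, u, v, huv, he⟩
      -- Division with remainder by `n` recovers row and column from a position in the matrix.
      have hmod := congrArg (· % n) he
      have hdiv := congrArg (· / n) he
      have hn : 0 < n := y.pos
      simp only [Nat.mul_add_mod', Nat.mod_eq_of_lt z.2, Nat.mod_eq_of_lt v.2] at hmod
      simp only [Nat.add_comm _ (z : ℕ), Nat.add_comm _ (v : ℕ), Nat.add_mul_div_right _ _ hn,
        Nat.div_eq_of_lt z.2, Nat.div_eq_of_lt v.2, zero_add] at hdiv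
      rw [Fin.ext hdiv, Fin.ext hmod] at hyz
      exact hyz huv
    · intro h
      rw [if_neg (by simp), if_pos ⟨rfl, y, z, h, rfl⟩]
      exact one_ne_zero

/-- The tables, the layering and the reachable configurations can be computed. -/
theorem task_main :
    Task (fun s s' => ∀ (n : ℕ) (G : SimpleGraph (Fin n)),
      s = (graphInput G).set 4 0 (2 * n + 2) →
      HasTables G 48 s' ∧ ∀ x : ℕ → ℕ, (∀ j < 49, x j < 2 * n + 2) →
        (s' 8 (address (2 * n + 2) 49 x) = 2 * n + 2 + 1 ↔
          Reachable 24 G (greedyLayering G (2 * n + 2)) (2 * n + 2) x)) := by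
  have hrow := Task.multiples (b := 9) (by decide) (by decide)
    (local_read (b := 0) (local_const 0) (by decide) (by decide) (by decide))
  refine (hrow.seq ((Task.powers 48).seq (task_greedyLayering.seq
    ((Task.write 8 (by decide) (.const 0) (.const 1)).seq (task_reachable 24))))).mono ?_
  rintro s s' ⟨s₁, ⟨ha, hr⟩, s₂, ⟨hb, hp⟩, s₃, hl, _, rfl, hd⟩ n G hs
  have h₀₁ : ∀ b i, b ≠ 2 → b ≠ 3 → b ≠ 9 → s b i = s₁ b i :=
    fun b i h₂ h₃ h₉ => ha b i h₃ h₉ fun h => absurd h h₂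
  have h₀₂ : ∀ b i, b ≠ 2 → b ≠ 3 → b ≠ 9 → b < 100 → s b i = s₂ b i :=
    fun b i h₂ h₃ h₉ h => (h₀₁ b i h₂ h₃ h₉).trans (hb b i h₂ h₃ h)
  have hs' : ∀ b i, b ≠ 4 → s b i = graphInput G b i := fun b i h => by
    rw [hs, State.set_bank h]
  have hsize : s 0 0 = n := by rw [hs' _ _ (by decide)]; simp [graphInput]
  have hlim : s 4 0 = 2 * n + 2 := by rw [hs, State.set_same]
  have ht₂ : HasTables G 48 s₂ := by
    refine hasTables_of_graphInput ?_ (fun i => ?_) ?_ (fun x hx => ?_) fun j hj x hx => ?_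
    · rw [← h₀₂ _ _ (by decide) (by decide) (by decide) (by decide), hsize]
    · rw [← h₀₂ _ _ (by decide) (by decide) (by decide) (by decide), hs' _ _ (by decide)]
    · rw [← h₀₂ _ _ (by decide) (by decide) (by decide) (by decide), hlim]
    · rw [← hb _ _ (by decide) (by decide) (by decide), hr x (by rwa [hlim])]
      simp [Expr.val, hsize]
    · rw [← h₀₁ _ _ (by decide) (by decide) (by decide), hlim] at hp
      exact hp j hj x hx
  obtain ⟨ht₃, hlam, hz⟩ := hl n 48 G ht₂ fun b i h₅ h₈ => by
    rw [← h₀₂ _ _ (by omega) (by omega) (by omega) (by omega), hs' _ _ (by omega), graphInput,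
      if_neg (by omega), if_neg (by omega)]
  exact hd n G _ (ht₃.congr fun b i h => (State.set_bank (by omega) _).symm)
    (fun y => by rw [State.set_bank (by decide), hlam])
    (fun i => by rw [State.set_bank (by decide), hz _ _ (by decide) (by decide)])
    fun i => by
      by_cases hi : i = 0
      · simp [hi, Expr.val]
      · rw [State.set_index (by simpa [Expr.val] using hi), if_neg hi,
          hz _ _ (by decide) (by decide)]

/-- A search for the least value of register `0` of bank `0` for which the expression vanishes. -/
theorem exec_search {e : Expr} {m : ℕ} {s : State} (h : ∀ c < m, e.val (s.set 0 0 c) ≠ 0)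
    (hm : e.val (s.set 0 0 m) = 0) :
    ∃ t, Exec (.seq (.write 0 (.const 0) (.const 0)) (.loop e (.write 0 (.const 0)
      (.add (.read 0 (.const 0)) (.const 1))))) s (s.set 0 0 m) t ∧
      t ≤ (m + 1) * (e.cost + 10) + 3 := by
  have hset : ∀ c d, (s.set 0 0 c).set 0 0 d = s.set 0 0 d := by
    intro c d
    funext b i
    simp only [State.set]
    split_ifs <;> rfl
  have key : ∀ r c, c + r = m → ∃ t, Exec (.loop e (.write 0 (.const 0)
      (.add (.read 0 (.const 0)) (.const 1)))) (s.set 0 0 c) (s.set 0 0 m) t ∧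
      t ≤ (r + 1) * (e.cost + 10) := by
    intro r
    induction r with
    | zero =>
      rintro c rfl
      exact ⟨_, Exec.loop_false hm, by omega⟩
    | succ r ih =>
      intro c hc
      obtain ⟨t, ht, hle⟩ := ih (c + 1) (by omega)
      have hw := Exec.write 0 (.const 0) (.add (.read 0 (.const 0)) (.const 1)) (s.set 0 0 c)
      simp only [Expr.val, Expr.cost, State.set_same, hset] at hw
      refine ⟨_, Exec.loop_true (h c (by omega)) hw ht, ?_⟩
      have : (r + 1 + 1) * (e.cost + 10) = (r + 1) * (e.cost + 10) + (e.cost + 10) := by ring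
      omega
  obtain ⟨t, ht, hle⟩ := key m 0 (by omega)
  refine ⟨_, Exec.seq (Exec.write _ _ _ _) ht, ?_⟩
  simp only [Expr.cost]
  omega

/-- The expression vanishes if the final configuration whose cost is in register `0` of bank `0`
can be reached. -/
def finalTest : Expr :=
  .add (.sub (.read 8 (.read 148 (.read 0 (.const 0)))) (.add .lim (.const 1)))
    (.sub (.add .lim (.const 1)) (.read 8 (.read 148 (.read 0 (.const 0)))))

/-- Empty blocks and cost `c` give the address `c * N ^ 48`, which is entry `c` of bank 148. Besides
the candidate itself, the test reads only banks 4, 8 and 148, so the search may overwrite the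
register that held `n`. -/
theorem val_finalTest_eq_zero_iff {n : ℕ} {G : SimpleGraph (Fin n)} {s : State}
    (hs : HasTables G 48 s) {R : (ℕ → ℕ) → Prop}
    (h : ∀ x : ℕ → ℕ, (∀ j < 49, x j < 2 * n + 2) →
      (s 8 (address (2 * n + 2) 49 x) = 2 * n + 2 + 1 ↔ R x)) {c : ℕ} (hc : c < 2 * n + 2) :
    finalTest.val (s.set 0 0 c) = 0 ↔ R (fun j => if j = 48 then c else 0) := by
  rw [← h _ fun j _ => by split_ifs <;> omega]
  have hadr : address (2 * n + 2) 49 (fun j => if j = 48 then c else 0) = s 148 c := by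
    rw [hs.pow 48 le_rfl c hc.le, address, Finset.sum_eq_single 48]
    · simp
    · intro j _ hj
      simp [hj]
    · simp
  rw [hadr]
  simp only [finalTest, Expr.val, State.set_same]
  rw [State.set_bank (by decide), State.set_bank (by decide), State.set_bank (by decide), hs.lim]
  omega

end RAM

theorem mainTheorem8 :
    PolyTimeComputableOn
      (fun (n : ℕ) (G : SimpleGraph (Fin n)) => IsPermutationGraph G)
      (fun (n : ℕ) (G : SimpleGraph (Fin n)) => rainbowDominationNumber 2 G) := by
  obtain ⟨P, p, hP⟩ := RAM.task_main
  refine ⟨.seq (.write 4 (.const 0) (.add (.add (.read 0 (.const 0)) (.read 0 (.const 0)))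
    (.const 2))) (.seq P (.seq (.write 0 (.const 0) (.const 0)) (.loop RAM.finalTest
      (.write 0 (.const 0) (.add (.read 0 (.const 0)) (.const 1)))))),
    -- The running times so far are polynomials in the loop bound; composition with `2 * X + 2`
    -- expresses them in `n`.
    (p + (Polynomial.X + Polynomial.C 1) * Polynomial.C (RAM.finalTest.cost + 10) +
      Polynomial.C 20).comp (Polynomial.C 2 * Polynomial.X + Polynomial.C 2), fun n G hG => ?_⟩
  have hw := RAM.Exec.write 4 (.const 0) (.add (.add (.read 0 (.const 0)) (.read 0 (.const 0)))
    (.const 2)) (RAM.graphInput G)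
  have h0 : RAM.graphInput G 0 0 = n := by simp [RAM.graphInput]
  simp only [RAM.Expr.val, h0, ← two_mul] at hw
  obtain ⟨s, t, he, ht, -, hs⟩ := hP ((RAM.graphInput G).set 4 0 (2 * n + 2))
  obtain ⟨htab, hreach⟩ := hs n G rfl
  rw [RAM.State.set_same] at ht
  have hlt := rainbowDominationNumber_two_lt G
  obtain ⟨hmem, hleast⟩ := rainbowDominationNumber_isLeast_reachable hG
    (isLayering_greedyLayering G (T := 2 * n + 2) (by omega)) (greedyLayering_le_card G (by omega))
  obtain ⟨t', he', ht'⟩ := RAM.exec_search (e := RAM.finalTest) (s := s)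
    (m := rainbowDominationNumber 2 G)
    (fun c hc => by
      rw [Ne, RAM.val_finalTest_eq_zero_iff htab hreach (hc.trans hlt)]
      exact fun h => absurd (hleast h) (not_le.mpr hc))
    ((RAM.val_finalTest_eq_zero_iff htab hreach hlt).mpr hmem)
  refine ⟨_, _, RAM.Exec.seq hw (RAM.Exec.seq he he'), ?_, RAM.State.set_same _ _ _ _⟩
  have hmul : (rainbowDominationNumber 2 G + 1) * (RAM.finalTest.cost + 10) ≤
      (2 * n + 2 + 1) * (RAM.finalTest.cost + 10) := Nat.mul_le_mul_right _ (by omega)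
  simp only [Polynomial.eval_comp, Polynomial.eval_add, Polynomial.eval_mul, Polynomial.eval_C,
    Polynomial.eval_X, RAM.Expr.cost]
  omega
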